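/- Let $\mathbb{L}_{\ge 0}=\omega_1\times[0,1)$ be the closed long ray, with the topology of the lexicographic order, let $\mathbb{L}_+=\mathbb{L}_{\ge 0}\setminus\{\langle 0,0\rangle\}$, and identify $\alpha\in\omega_1$ with $\langle\alpha,0\rangle$. Fix any smoothing of $\mathbb{L}_+$, that is, a smooth atlas compatible with its topology (a $C^1$ atlas suffices). Let $TL^+$ be the total space of the resulting tangent bundle, let $T^+\subset TL^+$ be the open subspace of positive (upward pointing) nonzero tangent vectors, and let $\pi:T^+\to\mathbb{L}_+$ be the restriction of the bundle projection. Then: (a) If $h:T^+\times[0,1]\to\mathbb{L}_+$ is continuous, $h_t=h(\cdot,t)$, and $h_{t_0}(T^+)$ is Lindelöf for some $t_0\in[0,1]$, then for every $t\in[0,1]$ there is a closed unbounded set $C\subset\omega_1$ such that $h_t$ is constant on $\pi^{-1}(C)$. (b) $T^+$ is not contractible. (c) Neither $T^+$ nor $TL^+$ is homotopy equivalent to a CW-complex. -/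

import Mathlib

open scoped Manifold ContDiff Ordinal

/-- The closed long ray `ω₁ × [0, 1)`, as a set with its lexicographic order. -/
def ClosedLongRay : Type :=
  (ω₁ : Ordinal.{0}).ToType ×ₗ Set.Ico (0 : ℝ) 1

namespace ClosedLongRay

noncomputable instance : LinearOrder ClosedLongRay :=
  inferInstanceAs (LinearOrder ((ω₁ : Ordinal.{0}).ToType ×ₗ Set.Ico (0 : ℝ) 1))

/-- The closed long ray carries the order topology. -/
noncomputable instance : TopologicalSpace ClosedLongRay := Preorder.topology ClosedLongRay

instance : OrderTopology ClosedLongRay := ⟨rfl⟩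

/-- The inclusion `α ↦ ⟨α, 0⟩` of `ω₁` in the closed long ray. -/
def ofOrdinal (α : (ω₁ : Ordinal.{0}).ToType) : ClosedLongRay :=
  toLex (α, ⟨0, le_refl 0, zero_lt_one⟩)

end ClosedLongRay

/-- The (open) long ray `𝕃₊`: the closed long ray with its least point `⟨0, 0⟩` removed,
with the subspace topology. -/
abbrev LongRay : Type := {x : ClosedLongRay // ¬ IsMin x}

section Tangent

variable [ChartedSpace ℝ LongRay]

/-- A tangent vector `w` at `x` is positive if it points upwards along the order of the long ray:
some nondecreasing real function that is differentiable at `x` has a positive derivative along `w`.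
Every nonzero tangent vector is either positive or the opposite of a positive one. -/
def IsPositiveTangent (x : LongRay) (w : TangentSpace 𝓘(ℝ, ℝ) x) : Prop :=
  ∃ f : LongRay → ℝ, Monotone f ∧ MDifferentiableAt 𝓘(ℝ, ℝ) 𝓘(ℝ, ℝ) f x ∧
    (0 : ℝ) < mfderiv 𝓘(ℝ, ℝ) 𝓘(ℝ, ℝ) f x w

/-- The total space `T𝕃₊` of the tangent bundle of the long ray. -/
abbrev LongRayTangent : Type := TangentBundle 𝓘(ℝ, ℝ) LongRay

/-- The positive part `T⁺` of the tangent bundle of the long ray, with the subspace topology. -/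
abbrev PositiveTangent : Type := {p : LongRayTangent // IsPositiveTangent p.1 p.2}

/-- The bundle projection `π : T⁺ → 𝕃₊`. -/
def PositiveTangent.proj (p : PositiveTangent) : LongRay := p.1.1

/-- A function on `T⁺` is almost constant if there is a closed unbounded set `C` of countable
ordinals such that the function is constant on `π⁻¹(C)`. -/
def AlmostConstant {Y : Type*} (f : PositiveTangent → Y) : Prop :=
  ∃ C : Set (ω₁ : Ordinal.{0}).ToType, IsClub C ∧
    ∃ c : Y, ∀ p : PositiveTangent,
      (∃ α ∈ C, p.proj.1 = ClosedLongRay.ofOrdinal α) → f p = c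

end Tangent

/-- `X` is homotopy equivalent to a CW-complex (a Hausdorff space with a CW structure). -/
def IsHomotopyEquivCW.{u, v} (X : Type u) [TopologicalSpace X] : Prop :=
  ∃ (W : Type v) (_ : TopologicalSpace W) (_ : T2Space W),
    Nonempty (Topology.CWComplex (Set.univ : Set W)) ∧
      Nonempty (ContinuousMap.HomotopyEquiv X W)

universe v

/-! The core is that a continuous map from T⁺ to a second countable Hausdorff space is constant over
a club (`exists_club_const`). A vector of an open set U ⊆ T⁺ over x is the value at x of the
coordinate field of a rescaled chart, and this field stays in U on some (a, x]. If U has a vector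
over a point of a suitable club, a closing-off argument gives one a and strictly increasing
coordinates τ_y on (a, y], for arbitrarily large y, whose fields lie in U. Suppose V is disjoint
from U and has coordinates τ'_z of this kind. The derivatives of τ_y and τ'_z never agree, so their
difference is strictly monotone. After thinning both families, one always grows more slowly than the
other (`not_unbounded_reaches`). The slower family, taken as a single map into a space with the sup
metric, then has finite variation on bounded intervals, and this variation is strictly increasing in
the end point. The long ray is too long for such a real function (`not_dominated_families`).

For (a), the truncations `climb β` turn h into maps from T⁺ to C([0,1], ℝ), which are constant over
clubs. The set of times at which the values over a club are bounded is clopen, hence all of [0,1],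
and a bounded value is determined by countably many truncations. A contraction of T⁺ or TL⁺ would
make π constant over a club, whence (b).

For (c), over a compact interval both bundles are products of an interval with a line or an open
half-line. By Tietze, maps into them extend from closed subsets of compact Hausdorff spaces.
Induction over skeleta makes every map from a CW-complex to such a space nullhomotopic, so a
homotopy equivalence with a CW-complex would force contractibility. -/

open Set Filter Topology

/-! ### Countable ordinals and clubs. -/

/-- The set of countable ordinals. -/
abbrev OmegaOne : Type := (ω₁ : Ordinal.{0}).ToType

namespace OmegaOne

theorem cof_eq : Order.cof OmegaOne = Cardinal.aleph 1 := by
  rw [Ordinal.cof_toType, Cardinal.cof_omega_one]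

/-- This is the condition under which the intersection of two clubs is a club. -/
theorem cof_ne : Order.cof OmegaOne ≠ Cardinal.aleph0 := by
  rw [cof_eq]
  exact Cardinal.aleph0_lt_aleph_one.ne'

theorem exists_gt_of_countable {s : Set OmegaOne} (hs : s.Countable) : ∃ b, ∀ a ∈ s, a < b := by
  have h : ¬ IsCofinal s := fun h => by
    have := Order.cof_le h
    rw [cof_eq] at this
    exact absurd (this.trans (Cardinal.mk_le_aleph0_iff.2 hs.to_subtype))
      (not_le.2 Cardinal.aleph0_lt_aleph_one)
  simpa [IsCofinal] using h

instance : NoMaxOrder OmegaOne :=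
  ⟨fun a => (exists_gt_of_countable (countable_singleton a)).imp fun _ h => h a rfl⟩

instance : Nonempty OmegaOne := (exists_gt_of_countable countable_empty).nonempty

theorem countable_Iio (a : OmegaOne) : (Iio a).Countable := by
  have h : Cardinal.mk (Iio a) < Cardinal.aleph 1 := by
    have := Cardinal.mk_Iio_lt a (by
      rw [Cardinal.mk_toType, Ordinal.card_omega, Cardinal.ord_aleph, Ordinal.type_toType])
    rwa [Cardinal.mk_toType, Ordinal.card_omega] at this
  rw [← Cardinal.le_aleph0_iff_set_countable]
  rw [← Cardinal.succ_aleph0] at h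
  exact Order.lt_succ_iff.1 h

theorem countable_Iic (a : OmegaOne) : (Iic a).Countable := by
  rw [← Iio_union_right]
  exact (countable_Iio a).union (countable_singleton a)

theorem not_countable : ¬ (univ : Set OmegaOne).Countable := fun h => by
  obtain ⟨b, hb⟩ := exists_gt_of_countable h
  exact lt_irrefl b (hb b trivial)

/-- The closure points of a function on `ω₁` form a club. -/
theorem isClub_closurePoints (b : OmegaOne → OmegaOne) :
    IsClub {δ : OmegaOne | (∃ γ, γ < δ) ∧ ∀ γ < δ, b γ < δ} := by
  constructor
  · intro d hd hne _ a ha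
    by_cases had : a ∈ d
    · exact hd had
    have hlt : ∀ x ∈ d, x < a := fun x hx => lt_of_le_of_ne (ha.1 hx) fun h => had (h ▸ hx)
    refine ⟨hne.imp hlt, fun γ hγ => ?_⟩
    obtain ⟨x, hx, hγx⟩ := (lt_isLUB_iff ha).1 hγ
    exact ((hd hx).2 γ hγx).trans (hlt x hx)
  · intro a
    have hstep : ∀ c : OmegaOne, ∃ c', c < c' ∧ ∀ γ ≤ c, b γ < c' := fun c => by
      obtain ⟨c₁, h₁⟩ := exists_gt_of_countable (((countable_Iic c).image b).insert c)
      exact ⟨c₁, h₁ c (mem_insert _ _), fun γ hγ => h₁ _ (mem_insert_of_mem _ ⟨γ, hγ, rfl⟩)⟩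
    choose g hg hgb using hstep
    -- The supremum of the iterates of `g` is a closure point: any γ below it is below some iterate,
    -- and the next iterate exceeds `b γ`.
    let u : ℕ → OmegaOne := fun n => g^[n] a
    have hu : ∀ n, u (n + 1) = g (u n) := fun n => Function.iterate_succ_apply' g n a
    have hub : {c | ∀ n, u n < c}.Nonempty := by
      obtain ⟨c, hc⟩ := exists_gt_of_countable (countable_range u)
      exact ⟨c, fun n => hc _ ⟨n, rfl⟩⟩
    let δ := wellFounded_lt.min {c | ∀ n, u n < c} hub
    have hδ : ∀ n, u n < δ := wellFounded_lt.min_mem _ hub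
    refine ⟨δ, ⟨⟨a, hδ 0⟩, fun γ hγ => ?_⟩, (hδ 0).le⟩
    have : ∃ n, γ ≤ u n := by
      by_contra! h
      exact wellFounded_lt.not_lt_min {c | ∀ n, u n < c} h hγ
    obtain ⟨n, hn⟩ := this
    exact ((hgb (u n) γ hn).trans_eq (hu n).symm).trans (hδ _)

end OmegaOne

/-! ### Order and topology of the long ray. -/

namespace LongRay

/-- The countable ordinal below a point of the long ray. -/
def idx (x : LongRay) : OmegaOne := (ofLex (α := OmegaOne × Ico (0 : ℝ) 1) x.1).1

/-- The distance of a point of the long ray to the ordinal below it. -/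
def frac (x : LongRay) : ℝ := ((ofLex (α := OmegaOne × Ico (0 : ℝ) 1) x.1).2 : ℝ)

theorem frac_nonneg (x : LongRay) : 0 ≤ frac x := (ofLex (α := OmegaOne × Ico (0 : ℝ) 1) x.1).2.2.1

theorem frac_lt_one (x : LongRay) : frac x < 1 := (ofLex (α := OmegaOne × Ico (0 : ℝ) 1) x.1).2.2.2

theorem lt_iff {x y : LongRay} : x < y ↔ idx x < idx y ∨ idx x = idx y ∧ frac x < frac y :=
  Prod.Lex.lt_iff (α := OmegaOne) (β := Ico (0 : ℝ) 1) (x := x.1) (y := y.1)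

theorem ext {x y : LongRay} (h : idx x = idx y) (h' : frac x = frac y) : x = y :=
  Subtype.ext (Prod.ext (β := Ico (0 : ℝ) 1) h (Subtype.ext h'))

theorem idx_mono {x y : LongRay} (h : x ≤ y) : idx x ≤ idx y := by
  by_contra! h'
  exact absurd h (not_le.2 (lt_iff.2 (Or.inl h')))

theorem exists_mk (a : OmegaOne) (r : ℝ) (h0 : 0 ≤ r) (h1 : r < 1)
    (h : (∃ b, b < a) ∨ 0 < r) : ∃ x : LongRay, idx x = a ∧ frac x = r := by
  refine ⟨⟨toLex (α := OmegaOne × Ico (0 : ℝ) 1) (a, ⟨r, h0, h1⟩), ?_⟩, rfl, rfl⟩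
  refine not_isMin_iff.2 ?_
  obtain ⟨b, hb⟩ | hr := h
  · exact ⟨ClosedLongRay.ofOrdinal b, Prod.Lex.lt_iff.2 (Or.inl hb)⟩
  · exact ⟨ClosedLongRay.ofOrdinal a, Prod.Lex.lt_iff.2 (Or.inr ⟨rfl, hr⟩)⟩

theorem exists_lt_idx_or_frac_pos (x : LongRay) : (∃ b, b < idx x) ∨ 0 < frac x := by
  obtain ⟨y, hy⟩ := not_isMin_iff.1 x.2
  obtain h | h := (Prod.Lex.lt_iff (α := OmegaOne) (β := Ico (0 : ℝ) 1) (x := y) (y := x.1)).1 hy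
  · exact Or.inl ⟨_, h⟩
  · exact Or.inr (lt_of_le_of_lt (ofLex (α := OmegaOne × Ico (0 : ℝ) 1) y).2.2.1 h.2)

instance : DenselyOrdered LongRay where
  dense x y hxy := by
    obtain h | ⟨h, h'⟩ := lt_iff.1 hxy
    · obtain ⟨z, hz, hz'⟩ := exists_mk (idx x) ((frac x + 1) / 2)
        (by linarith [frac_nonneg x]) (by linarith [frac_lt_one x])
        (Or.inr (by linarith [frac_nonneg x]))
      exact ⟨z, lt_iff.2 (Or.inr ⟨hz.symm, by linarith [frac_lt_one x]⟩), lt_iff.2 (Or.inl (hz ▸ h))⟩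
    · obtain ⟨z, hz, hz'⟩ := exists_mk (idx x) ((frac x + frac y) / 2)
        (by linarith [frac_nonneg x, frac_nonneg y]) (by linarith [frac_lt_one x, frac_lt_one y])
        (Or.inr (by linarith [frac_nonneg x, frac_nonneg y]))
      exact ⟨z, lt_iff.2 (Or.inr ⟨hz.symm, by linarith⟩), lt_iff.2 (Or.inr ⟨hz.trans h, by linarith⟩)⟩

theorem exists_idx_eq_of_lt {a b : OmegaOne} (h : a < b) : ∃ x : LongRay, idx x = b ∧ frac x = 0 :=
  exists_mk b 0 le_rfl one_pos (Or.inl ⟨a, h⟩)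

instance : NoMaxOrder LongRay where
  exists_gt x := by
    obtain ⟨b, hb⟩ := exists_gt (idx x)
    obtain ⟨z, hz, -⟩ := exists_idx_eq_of_lt hb
    exact ⟨z, lt_iff.2 (Or.inl (hz ▸ hb))⟩

instance : NoMinOrder LongRay where
  exists_lt x := by
    obtain ⟨b, hb⟩ | h := exists_lt_idx_or_frac_pos x
    · obtain ⟨z, hz, -⟩ := exists_mk b (1 / 2) (by norm_num) (by norm_num) (Or.inr (by norm_num))
      exact ⟨z, lt_iff.2 (Or.inl (hz ▸ hb))⟩
    · obtain ⟨z, hz, hz'⟩ := exists_mk (idx x) (frac x / 2) (by positivity)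
        (by linarith [frac_lt_one x]) (Or.inr (by positivity))
      exact ⟨z, lt_iff.2 (Or.inr ⟨hz, by linarith⟩)⟩

instance : Nonempty LongRay := by
  obtain ⟨a⟩ := (inferInstance : Nonempty OmegaOne)
  obtain ⟨z, -⟩ := exists_mk a (1 / 2) (by norm_num) (by norm_num) (Or.inr (by norm_num))
  exact ⟨z⟩

theorem exists_isGLB {s : Set LongRay} (hs : s.Nonempty) (hb : BddBelow s) : ∃ x, IsGLB s x := by
  obtain ⟨w, hw⟩ := hb
  let a := wellFounded_lt.min (idx '' s) (hs.image _)
  obtain ⟨x₀, hx₀, hx₀a⟩ : a ∈ idx '' s := wellFounded_lt.min_mem _ _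
  have hmin : ∀ x ∈ s, a ≤ idx x := fun x hx =>
    not_lt.1 (wellFounded_lt.not_lt_min (idx '' s) ⟨x, hx, rfl⟩)
  let F := frac '' {x ∈ s | idx x = a}
  have hFne : F.Nonempty := ⟨_, x₀, ⟨hx₀, hx₀a⟩, rfl⟩
  have hFb : ∀ r ∈ F, 0 ≤ r := by
    rintro _ ⟨x, -, rfl⟩
    exact frac_nonneg x
  have hF : IsGLB F (sInf F) := isGLB_csInf hFne ⟨0, hFb⟩
  have h0 : 0 ≤ sInf F := hF.2 hFb
  have h1 : sInf F < 1 := (hF.1 ⟨x₀, ⟨hx₀, hx₀a⟩, rfl⟩).trans_lt (frac_lt_one x₀)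
  have hwa : idx w ≤ a := hx₀a ▸ idx_mono (hw hx₀)
  -- The candidate could only be the removed point ⟨0, 0⟩. This is excluded because the lower bound
  -- `w` would then have index `a` and a positive fractional part below all of `F`.
  obtain ⟨g, hg, hg'⟩ := exists_mk a (sInf F) h0 h1 (by
    by_contra! h
    have hwe : idx w = a := hwa.eq_of_not_lt (h.1 _).not_gt
    have hw0 : 0 < frac w := (exists_lt_idx_or_frac_pos w).resolve_left
      fun ⟨b, hb⟩ => (h.1 b).not_gt (hwe ▸ hb)
    refine absurd (hw0.trans_le (hF.2 ?_)) h.2.not_gt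
    rintro _ ⟨x, hx, rfl⟩
    by_contra! hlt
    exact absurd (hw hx.1) (not_le.2 (lt_iff.2 (Or.inr ⟨hx.2.trans hwe.symm, hlt⟩))))
  refine ⟨g, fun x hx => ?_, fun y hy => ?_⟩
  · by_contra! hlt
    obtain h | ⟨h, h'⟩ := lt_iff.1 hlt
    · exact (hmin x hx).not_gt (hg ▸ h)
    · exact (hF.1 ⟨x, ⟨hx, h.trans hg⟩, rfl⟩).not_gt (hg' ▸ h')
  · by_contra! hlt
    obtain h | ⟨h, h'⟩ := lt_iff.1 hlt
    · exact absurd (idx_mono (hy hx₀)) (not_le.2 (by rwa [hx₀a, ← hg]))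
    · rw [hg'] at h'
      obtain ⟨_, ⟨x, hx, rfl⟩, hxy⟩ := (isGLB_lt_iff hF).1 h'
      exact absurd (hy hx.1) (not_le.2 (lt_iff.2 (Or.inr ⟨by rw [hx.2, ← h, hg], hxy⟩)))

theorem exists_isLUB {s : Set LongRay} (hs : s.Nonempty) (hb : BddAbove s) : ∃ x, IsLUB s x := by
  obtain ⟨x, hx⟩ := exists_isGLB (s := upperBounds s) hb (hs.imp fun y hy z hz => hz hy)
  exact ⟨x, isGLB_upperBounds.1 hx⟩

-- Completeness provides compact intervals, intermediate values and Rolle's theorem on the long ray.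
open Classical in
noncomputable instance : ConditionallyCompleteLinearOrder LongRay where
  __ := (inferInstance : LinearOrder LongRay)
  __ := (inferInstance : Lattice LongRay)
  sSup s := if h : s.Nonempty ∧ BddAbove s then (exists_isLUB h.1 h.2).choose
    else Classical.arbitrary _
  sInf s := if h : s.Nonempty ∧ BddBelow s then (exists_isGLB h.1 h.2).choose
    else Classical.arbitrary _
  isLUB_csSup s h h' := by
    rw [dif_pos ⟨h, h'⟩]
    exact (exists_isLUB h h').choose_spec
  isGLB_csInf s h h' := by
    rw [dif_pos ⟨h, h'⟩]
    exact (exists_isGLB h h').choose_spec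
  csSup_of_not_bddAbove s h := by
    rw [dif_neg fun h' => h (And.right h'),
      dif_neg fun h' => Set.not_nonempty_empty (And.left h')]
  csInf_of_not_bddBelow s h := by
    rw [dif_neg fun h' => h (And.right h'),
      dif_neg fun h' => Set.not_nonempty_empty (And.left h')]

instance : OrdConnected {x : ClosedLongRay | ¬ IsMin x} where
  out' _ hx _ _ _ hz := fun h => hx (h.mono hz.1)

instance : OrderTopology LongRay :=
  orderTopology_of_ordConnected (t := {x : ClosedLongRay | ¬ IsMin x})

/-- The monotone function on the long ray that climbs from `0` to `1` on `[α, α + 1]`. -/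
noncomputable def climb (α : OmegaOne) (x : LongRay) : ℝ :=
  if idx x < α then 0 else if idx x = α then frac x else 1

theorem climb_mem (α : OmegaOne) (x : LongRay) : climb α x ∈ Icc (0 : ℝ) 1 := by
  unfold climb
  split_ifs
  · simp
  · exact ⟨frac_nonneg x, (frac_lt_one x).le⟩
  · simp

theorem climb_of_lt {α : OmegaOne} {x : LongRay} (h : idx x < α) : climb α x = 0 := if_pos h

theorem idx_le_of_climb_lt_one {α : OmegaOne} {x : LongRay} (h : climb α x < 1) : idx x ≤ α := by
  by_contra! h'
  rw [climb, if_neg h'.not_gt, if_neg h'.ne'] at h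
  exact lt_irrefl _ h

theorem climb_monotone (α : OmegaOne) : Monotone (climb α) := by
  intro x y hxy
  rcases lt_trichotomy (idx x) α with h | h | h
  · rw [climb_of_lt h]
    exact (climb_mem α y).1
  · rcases hxy.eq_or_lt with rfl | hlt
    · rfl
    have hx : climb α x = frac x := by rw [climb, if_neg h.not_lt, if_pos h]
    obtain h' | ⟨h', hf⟩ := lt_iff.1 hlt
    · rw [h] at h'
      rw [hx, climb, if_neg h'.not_gt, if_neg h'.ne']
      exact (frac_lt_one x).le
    · rw [hx, climb, if_neg (h' ▸ h).not_lt, if_pos (h' ▸ h)]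
      exact hf.le
  · have h' := h.trans_le (idx_mono hxy)
    rw [climb, climb, if_neg h.not_gt, if_neg h.ne', if_neg h'.not_gt, if_neg h'.ne']

/-- The truncation at the index of a point reads off its fractional part, which is less than 1,
whereas at any larger index it is 1. Only countably many truncations are needed for bounded points.
-/
theorem eq_of_climb_eq {α : OmegaOne} {x y : LongRay} (hx : idx x ≤ α) (hy : idx y ≤ α)
    (h : ∀ β ≤ α, climb β x = climb β y) : x = y := by
  have key : ∀ {x y : LongRay}, idx y ≤ α → (∀ β ≤ α, climb β x = climb β y) → ¬ idx x < idx y := by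
    intro x y hy h hlt
    have h1 := h (idx x) (hlt.le.trans hy)
    rw [climb, if_neg (lt_irrefl _), if_pos rfl, climb, if_neg hlt.not_gt, if_neg hlt.ne'] at h1
    exact (frac_lt_one x).ne h1
  have he : idx x = idx y := le_antisymm (not_lt.1 (key hx fun β hβ => (h β hβ).symm))
    (not_lt.1 (key hy h))
  refine ext he ?_
  have h1 := h (idx x) hx
  rwa [climb, if_neg (lt_irrefl _), if_pos rfl, climb, if_neg he.not_gt, if_pos he.symm] at h1

theorem continuous_climb (α : OmegaOne) : Continuous (climb α) := by
  have hmono : Monotone fun x => (⟨climb α x, climb_mem α x⟩ : Icc (0 : ℝ) 1) :=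
    fun x y h => climb_monotone α h
  refine continuous_subtype_val.comp (hmono.continuous_of_denseRange ?_)
  -- The value 0 is left out because it is not attained when `α` is the least ordinal.
  refine (dense_compl_singleton (⟨0, by simp⟩ : Icc (0 : ℝ) 1)).mono fun r hr => ?_
  have hr0 : 0 < (r : ℝ) := lt_of_le_of_ne r.2.1 fun h => hr (Subtype.ext h.symm)
  obtain h1 | h1 := r.2.2.lt_or_eq
  · obtain ⟨x, hx, hx'⟩ := exists_mk α r hr0.le h1 (Or.inr hr0)
    exact ⟨x, Subtype.ext (by simp [climb, hx, hx'])⟩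
  · obtain ⟨b, hb⟩ := exists_gt α
    obtain ⟨x, hx, -⟩ := exists_idx_eq_of_lt hb
    refine ⟨x, Subtype.ext ?_⟩
    simp [climb, hx, hb.not_gt, hb.ne', h1]

end LongRay

/-! ### Real functions against the length of the ray. -/

namespace LongRay

theorem exists_gt_of_countable {s : Set LongRay} (hs : s.Countable) : ∃ b, ∀ a ∈ s, a < b := by
  obtain ⟨b, hb⟩ := OmegaOne.exists_gt_of_countable (hs.image idx)
  obtain ⟨c, hc⟩ := exists_gt b
  obtain ⟨x, hx, -⟩ := exists_idx_eq_of_lt hc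
  exact ⟨x, fun a ha => lt_iff.2 (Or.inl (hx ▸ (hb _ ⟨a, ha, rfl⟩).trans hc))⟩

/-- The long ray is too long for a real function to be strictly increasing on a final segment. -/
theorem not_strictMonoOn_Ici (x₀ : LongRay) (T : LongRay → ℝ) : ¬ StrictMonoOn T (Ici x₀) := by
  intro hT
  have hp : ∀ a : Ioi (idx x₀), ∃ x y : LongRay, x₀ < x ∧ x < y ∧ idx x = a ∧ idx y = a ∧
      frac x = 0 := by
    rintro ⟨a, ha⟩
    obtain ⟨x, hx, hx'⟩ := exists_idx_eq_of_lt ha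
    obtain ⟨y, hy, hy'⟩ := exists_mk a (1 / 2) (by norm_num) (by norm_num) (Or.inr (by norm_num))
    refine ⟨x, y, lt_iff.2 (Or.inl (hx ▸ ha)), lt_iff.2 (Or.inr ⟨hx.trans hy.symm, ?_⟩), hx, hy, hx'⟩
    rw [hx', hy']
    norm_num
  choose p p' h0 hpp hp hp' hfr using hp
  -- Disjoint rational gaps over uncountably many ordinals would inject an uncountable set into ℚ.
  have hq : ∀ a, ∃ q : ℚ, T (p a) < q ∧ (q : ℝ) < T (p' a) := fun a =>
    exists_rat_btwn (hT (h0 a).le ((h0 a).trans (hpp a)).le (hpp a))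
  choose q hq hq' using hq
  have hmono : StrictMono q := by
    intro a b hab
    have h1 : p' a < p b := lt_iff.2 (Or.inl (by rw [hp', hp]; exact hab))
    have h2 := hT ((h0 a).trans (hpp a)).le (h0 b).le h1
    exact_mod_cast ((hq' a).trans h2).trans (hq b)
  have hc : (Ioi (idx x₀)).Countable := hmono.injective.countable
  refine OmegaOne.not_countable ?_
  rw [← Iic_union_Ioi (a := idx x₀)]
  exact (OmegaOne.countable_Iic _).union hc

/-- A set of points of the long ray is unbounded if it has points above each given one. -/
def Unbounded (S : Set LongRay) : Prop := ∀ b, ∃ y ∈ S, b < y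

theorem Unbounded.mono {S S' : Set LongRay} (h : Unbounded S) (hS : S ⊆ S') : Unbounded S' :=
  fun b => (h b).imp fun _ hy => ⟨hS hy.1, hy.2⟩

theorem Unbounded.inter_Ioi {S : Set LongRay} (h : Unbounded S) (c : LongRay) :
    Unbounded (S ∩ Ioi c) := fun b => by
  obtain ⟨y, hy, hby⟩ := h (max b c)
  exact ⟨y, ⟨hy, (le_max_right _ _).trans_lt hby⟩, (le_max_left _ _).trans_lt hby⟩

/-- Countably many sets have a common bound beyond which only the unbounded ones have points. -/
theorem exists_bound_of_countable {ι : Type*} [Countable ι] (A : ι → Set LongRay) :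
    ∃ b, ∀ i, ∀ y ∈ A i, b < y → Unbounded (A i) := by
  have h : ∀ i, ∃ b, ∀ y ∈ A i, b < y → Unbounded (A i) := fun i => by
    by_cases hi : Unbounded (A i)
    · exact ⟨Classical.arbitrary _, fun _ _ _ => hi⟩
    · obtain ⟨b, hb⟩ := not_forall.1 hi
      exact ⟨b, fun y hy hby => absurd ⟨y, hy, hby⟩ hb⟩
  choose b hb using h
  obtain ⟨c, hc⟩ := exists_gt_of_countable (countable_range b)
  exact ⟨c, fun i y hy hcy => hb i y hy ((hc _ ⟨i, rfl⟩).trans hcy)⟩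

/-- Beyond a common bound, every rational sublevel or superlevel set that still has a point is
unbounded. One pair of points beyond it therefore suffices, with a rational between their two
values. -/
theorem exists_separating_real {S S' : Set LongRay} (hS : Unbounded S) (hS' : Unbounded S')
    (d d' : LongRay → ℝ) (h : ∃ b, ∀ y ∈ S, ∀ z ∈ S', b < y → b < z → d y ≠ d' z) :
    ∃ r : ℝ, (Unbounded {y ∈ S | d y < r} ∧ Unbounded {z ∈ S' | r < d' z}) ∨
      (Unbounded {y ∈ S | r < d y} ∧ Unbounded {z ∈ S' | d' z < r}) := by
  obtain ⟨b₁, h₁⟩ := exists_bound_of_countable fun r : ℚ => {y ∈ S | d y < r}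
  obtain ⟨b₂, h₂⟩ := exists_bound_of_countable fun r : ℚ => {y ∈ S | r < d y}
  obtain ⟨b₃, h₃⟩ := exists_bound_of_countable fun r : ℚ => {y ∈ S' | d' y < r}
  obtain ⟨b₄, h₄⟩ := exists_bound_of_countable fun r : ℚ => {y ∈ S' | r < d' y}
  obtain ⟨b₀, h₀⟩ := h
  obtain ⟨b, hb⟩ := exists_gt_of_countable (s := {b₀, b₁, b₂, b₃, b₄}) (by simp)
  simp only [mem_insert_iff, mem_singleton_iff, forall_eq_or_imp, forall_eq] at hb
  obtain ⟨hb0, hb1, hb2, hb3, hb4⟩ := hb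
  obtain ⟨y, hy, hby⟩ := hS b
  obtain ⟨z, hz, hbz⟩ := hS' b
  obtain hlt | hlt := (h₀ y hy z hz (hb0.trans hby) (hb0.trans hbz)).lt_or_gt
  · obtain ⟨r, hr, hr'⟩ := exists_rat_btwn hlt
    exact ⟨r, Or.inl ⟨h₁ r y ⟨hy, hr⟩ (hb1.trans hby), h₄ r z ⟨hz, hr'⟩ (hb4.trans hbz)⟩⟩
  · obtain ⟨r, hr, hr'⟩ := exists_rat_btwn hlt
    exact ⟨r, Or.inr ⟨h₂ r y ⟨hy, hr'⟩ (hb2.trans hby), h₃ r z ⟨hz, hr⟩ (hb3.trans hbz)⟩⟩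

/-- There are no two unbounded families of real functions on initial segments of a final segment
of the long ray such that the functions of one family are strictly increasing and always increase
less than those of the other. -/
theorem not_dominated_families {S S' : Set LongRay} (hS : Unbounded S) (hS' : Unbounded S')
    (x₀ : LongRay) (τ τ' : LongRay → LongRay → ℝ)
    (hpos : ∀ z ∈ S', StrictMonoOn (τ' z) (Icc x₀ z))
    (h : ∀ y ∈ S, ∀ z ∈ S', ∀ x x', x₀ ≤ x → x ≤ x' → x' ≤ y → x' ≤ z →
      τ' z x' - τ' z x ≤ τ y x' - τ y x) : False := by
  classical
  -- Each function is frozen beyond `z`, where nothing is known about it. The sup distance is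
  -- extended, so no uniform bound on the family is needed beforehand.
  let F : LongRay → UniformFun S' ℝ := fun x => UniformFun.ofFun fun z => τ' z (min x z)
  have hpos' : ∀ z ∈ S', ∀ x x', x₀ ≤ x → x ≤ x' → x' ≤ z → τ' z x ≤ τ' z x' :=
    fun z hz x x' h0 hxx hx => (hpos z hz).monotoneOn ⟨h0, hxx.trans hx⟩ ⟨h0.trans hxx, hx⟩ hxx
  have hτ : ∀ y ∈ S, MonotoneOn (τ y) (Icc x₀ y) := by
    intro y hy x hx x' hx' hxx
    obtain ⟨z, hz, hlt⟩ := hS' y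
    linarith [h y hy z hz x x' hx.1 hxx hx'.2 (hx'.2.trans hlt.le),
      hpos' z hz x x' hx.1 hxx (hx'.2.trans hlt.le)]
  have hF : ∀ y ∈ S, ∀ x x', x₀ ≤ x → x ≤ x' → x' ≤ y →
      edist (F x') (F x) ≤ edist (τ y x') (τ y x) := by
    intro y hy x x' h0 hxx hxy
    refine UniformFun.edist_le.2 ?_
    rintro ⟨z, hz⟩
    change edist (τ' z (min x' z)) (τ' z (min x z)) ≤ _
    rw [edist_dist, edist_dist]
    refine ENNReal.ofReal_le_ofReal ?_
    rw [Real.dist_eq, Real.dist_eq]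
    obtain hzx | hxz := le_total z x
    · rw [min_eq_right hzx, min_eq_right (hzx.trans hxx), sub_self, abs_zero]
      exact abs_nonneg _
    have hm : x ≤ min x' z := le_min hxx hxz
    have hmz : min x' z ≤ z := min_le_right _ _
    have hmy : min x' z ≤ y := (min_le_left _ _).trans hxy
    rw [min_eq_left hxz, abs_of_nonneg (sub_nonneg.2 (hpos' z hz _ _ h0 hm hmz)),
      abs_of_nonneg (sub_nonneg.2 (hτ y hy ⟨h0, hxx.trans hxy⟩ ⟨h0.trans hxx, hxy⟩ hxx))]
    linarith [h y hy z hz x _ h0 hm hmy hmz,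
      hτ y hy ⟨h0.trans hm, hmy⟩ ⟨h0.trans hxx, hxy⟩ (min_le_left x' z)]
  -- A single `τ y` with `y` beyond `x` dominates the increments of all the `τ' z` at once, and a
  -- monotone real function has finite variation on [x₀, y].
  have hfin : ∀ x, eVariationOn F (Icc x₀ x) ≠ ⊤ := by
    intro x
    obtain ⟨y, hy, hxy⟩ := hS (max x x₀)
    have hxy' : x ≤ y := (le_max_left _ _).trans hxy.le
    have h0y : x₀ ≤ y := (le_max_right _ _).trans hxy.le
    have h1 : eVariationOn F (Icc x₀ y) ≤ eVariationOn (τ y) (Icc x₀ y) := by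
      refine iSup_le ?_
      rintro ⟨n, u, hu, hus⟩
      refine le_trans (Finset.sum_le_sum fun i _ => ?_) (eVariationOn.sum_le (n := n) hu hus)
      exact hF y hy _ _ (hus i).1 (hu i.le_succ) (hus _).2
    have h2 := (hτ y hy).eVariationOn_eq (a := x₀) (b := y) ⟨le_rfl, h0y⟩ ⟨h0y, le_rfl⟩
    rw [inter_self] at h2
    exact ne_top_of_le_ne_top ENNReal.ofReal_ne_top
      ((eVariationOn.mono _ (Icc_subset_Icc_right hxy')).trans (h1.trans h2.le))
  refine not_strictMonoOn_Ici x₀ (fun x => (eVariationOn F (Icc x₀ x)).toReal) ?_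
  intro x hx x' hx' hxx
  rw [ENNReal.toReal_lt_toReal (hfin _) (hfin _)]
  have hadd := eVariationOn.Icc_add_Icc F (s := univ) (mem_Ici.1 hx) hxx.le trivial
  simp only [univ_inter] at hadd
  rw [← hadd]
  refine ENNReal.lt_add_right (hfin x) ?_
  have hle : edist (F x) (F x') ≤ eVariationOn F (Icc x x') :=
    eVariationOn.edist_le F ⟨le_rfl, hxx.le⟩ ⟨hxx.le, le_rfl⟩
  -- A function whose domain extends past `x'` is not yet frozen there, so its strict increase makes
  -- the added variation positive.
  obtain ⟨z, hz, hlt⟩ := hS' x'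
  have hle' : edist (τ' z x) (τ' z x') ≤ edist (F x) (F x') := by
    have := UniformFun.edist_le.1 (le_refl (edist (F x) (F x'))) ⟨z, hz⟩
    change edist (τ' z (min x z)) (τ' z (min x' z)) ≤ _ at this
    rwa [min_eq_left hlt.le, min_eq_left (hxx.le.trans hlt.le)] at this
  intro h0
  have : edist (τ' z x) (τ' z x') = 0 := le_antisymm (hle'.trans (hle.trans h0.le)) bot_le
  exact (hpos z hz ⟨hx, hxx.le.trans hlt.le⟩ ⟨hx', hlt.le⟩ hxx).ne (edist_eq_zero.1 this)

end LongRay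

/-! ### Calculus on the long ray and its tangent bundle. -/

namespace LongRay

variable [ChartedSpace ℝ LongRay]

/-- The derivative of a real function on the long ray, in the preferred chart at the point,
as a linear map. -/
noncomputable def chartDerivL (f : LongRay → ℝ) (x : LongRay) : ℝ →L[ℝ] ℝ :=
  mfderiv 𝓘(ℝ, ℝ) 𝓘(ℝ, ℝ) f x

/-- The derivative of a real function on the long ray in the preferred chart at the point. -/
noncomputable def chartDeriv (f : LongRay → ℝ) (x : LongRay) : ℝ := chartDerivL f x 1

theorem chartDerivL_apply (f : LongRay → ℝ) (x : LongRay) (w : ℝ) :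
    chartDerivL f x w = chartDeriv f x * w := by
  have h := (chartDerivL f x).map_smul w (1 : ℝ)
  rw [smul_eq_mul, smul_eq_mul, mul_one] at h
  rw [h, chartDeriv, mul_comm]

theorem isPositiveTangent_def {x : LongRay} {w : ℝ} : IsPositiveTangent x w ↔
    ∃ f : LongRay → ℝ, Monotone f ∧ MDifferentiableAt 𝓘(ℝ, ℝ) 𝓘(ℝ, ℝ) f x ∧
      0 < chartDeriv f x * w := by
  simp only [← chartDerivL_apply]
  exact Iff.rfl

theorem hasDerivAt_chartDeriv {f : LongRay → ℝ} {x : LongRay}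
    (hf : MDifferentiableAt 𝓘(ℝ, ℝ) 𝓘(ℝ, ℝ) f x) :
    HasDerivAt (f ∘ (chartAt ℝ x).symm) (chartDeriv f x) (chartAt ℝ x x) := by
  have h : HasFDerivWithinAt (f ∘ (chartAt ℝ x).symm) (chartDerivL f x) univ (chartAt ℝ x x) := by
    have h := hf.hasMFDerivAt.2
    simp only [mfld_simps] at h
    exact h
  exact h.hasFDerivAt_of_univ.hasDerivAt

theorem chartDeriv_eq {f : LongRay → ℝ} {x : LongRay} {d : ℝ}
    (hf : MDifferentiableAt 𝓘(ℝ, ℝ) 𝓘(ℝ, ℝ) f x)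
    (h : HasDerivAt (f ∘ (chartAt ℝ x).symm) d (chartAt ℝ x x)) : chartDeriv f x = d :=
  (hasDerivAt_chartDeriv hf).unique h

theorem _root_.MDifferentiableAt.sub_real {f g : LongRay → ℝ} {x : LongRay}
    (hf : MDifferentiableAt 𝓘(ℝ, ℝ) 𝓘(ℝ, ℝ) f x) (hg : MDifferentiableAt 𝓘(ℝ, ℝ) 𝓘(ℝ, ℝ) g x) :
    MDifferentiableAt 𝓘(ℝ, ℝ) 𝓘(ℝ, ℝ) (fun y => f y - g y) x :=
  MDifferentiableAt.sub hf hg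

theorem chartDeriv_sub {f g : LongRay → ℝ} {x : LongRay}
    (hf : MDifferentiableAt 𝓘(ℝ, ℝ) 𝓘(ℝ, ℝ) f x) (hg : MDifferentiableAt 𝓘(ℝ, ℝ) 𝓘(ℝ, ℝ) g x) :
    chartDeriv (fun y => f y - g y) x = chartDeriv f x - chartDeriv g x :=
  chartDeriv_eq (hf.sub_real hg) ((hasDerivAt_chartDeriv hf).sub (hasDerivAt_chartDeriv hg))

theorem mdifferentiableAt_const_mul {f : LongRay → ℝ} {x : LongRay} (c : ℝ)
    (hf : MDifferentiableAt 𝓘(ℝ, ℝ) 𝓘(ℝ, ℝ) f x) :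
    MDifferentiableAt 𝓘(ℝ, ℝ) 𝓘(ℝ, ℝ) (fun y => c * f y) x :=
  MDifferentiableAt.const_smul hf c

theorem chartDeriv_const_mul {f : LongRay → ℝ} {x : LongRay} (c : ℝ)
    (hf : MDifferentiableAt 𝓘(ℝ, ℝ) 𝓘(ℝ, ℝ) f x) :
    chartDeriv (fun y => c * f y) x = c * chartDeriv f x :=
  chartDeriv_eq (mdifferentiableAt_const_mul c hf) ((hasDerivAt_chartDeriv hf).const_mul c)

/-- Fermat: the derivative vanishes at a local extremum. -/
theorem chartDeriv_eq_zero_of_isLocalExtr {f : LongRay → ℝ} {x : LongRay}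
    (hf : MDifferentiableAt 𝓘(ℝ, ℝ) 𝓘(ℝ, ℝ) f x) (h : IsLocalExtr f x) : chartDeriv f x = 0 := by
  have hx := mem_chart_source ℝ x
  have ht : Tendsto (chartAt ℝ x).symm (𝓝 (chartAt ℝ x x)) (𝓝 x) := by
    have := (chartAt ℝ x).continuousAt_symm ((chartAt ℝ x).map_source hx)
    rwa [ContinuousAt, (chartAt ℝ x).left_inv hx] at this
  refine IsLocalExtr.hasDerivAt_eq_zero ?_ (hasDerivAt_chartDeriv hf)
  refine h.imp (fun h => ?_) fun h => ?_
  · refine (ht.eventually h).mono fun t ht => ?_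
    simpa [(chartAt ℝ x).left_inv hx] using ht
  · refine (ht.eventually h).mono fun t ht => ?_
    simpa [(chartAt ℝ x).left_inv hx] using ht

/-- Rolle's theorem makes the function injective, and continuous injective functions on an interval
are strictly monotone. No continuity of the derivative is required. -/
theorem strictMonoOn_or_strictAntiOn {f : LongRay → ℝ} {a b : LongRay} (hab : a ≤ b)
    (hf : ∀ x ∈ Icc a b, MDifferentiableAt 𝓘(ℝ, ℝ) 𝓘(ℝ, ℝ) f x)
    (h0 : ∀ x ∈ Icc a b, chartDeriv f x ≠ 0) :
    StrictMonoOn f (Icc a b) ∨ StrictAntiOn f (Icc a b) := by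
  have hc : ContinuousOn f (Icc a b) := fun x hx => (hf x hx).continuousAt.continuousWithinAt
  have key : ∀ x ∈ Icc a b, ∀ y ∈ Icc a b, x < y → f x ≠ f y := by
    intro x hx y hy hxy he
    obtain ⟨z, hz, hze⟩ := exists_isLocalExtr_Ioo hxy
      (hc.mono (Icc_subset_Icc hx.1 hy.2)) he
    have hz' : z ∈ Icc a b := ⟨hx.1.trans hz.1.le, hz.2.le.trans hy.2⟩
    exact h0 z hz' (chartDeriv_eq_zero_of_isLocalExtr (hf z hz') hze)
  refine hc.strictMonoOn_of_injOn_Icc' hab fun x hx y hy he => ?_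
  by_contra hne
  obtain h | h := lt_or_gt_of_ne hne
  · exact key x hx y hy h he
  · exact key y hy x hx h he.symm

/-- Two functions that are monotone in the same sense have derivatives of the same sign. -/
theorem chartDeriv_mul_nonneg {f g : LongRay → ℝ} {x : LongRay}
    (hf : MDifferentiableAt 𝓘(ℝ, ℝ) 𝓘(ℝ, ℝ) f x) (hg : MDifferentiableAt 𝓘(ℝ, ℝ) 𝓘(ℝ, ℝ) g x)
    (h : ∀ᶠ y in 𝓝 x, 0 ≤ (f y - f x) * (g y - g x)) : 0 ≤ chartDeriv f x * chartDeriv g x := by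
  have hx := mem_chart_source ℝ x
  have ht : Tendsto (chartAt ℝ x).symm (𝓝 (chartAt ℝ x x)) (𝓝 x) := by
    have := (chartAt ℝ x).continuousAt_symm ((chartAt ℝ x).map_source hx)
    rwa [ContinuousAt, (chartAt ℝ x).left_inv hx] at this
  have h1 := (hasDerivAt_iff_tendsto_slope.1 (hasDerivAt_chartDeriv hf)).mul
    (hasDerivAt_iff_tendsto_slope.1 (hasDerivAt_chartDeriv hg))
  refine ge_of_tendsto h1 ?_
  filter_upwards [(ht.eventually h).filter_mono nhdsWithin_le_nhds] with t ht
  simp only [slope_def_field, Function.comp_apply, (chartAt ℝ x).left_inv hx]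
  rw [div_mul_div_comm]
  exact div_nonneg ht (mul_self_nonneg _)

/-- Functions increasing near a point cannot have derivatives of opposite signs there, so one local
coordinate decides positivity. Clamping the coordinate to [a, b] makes it a globally monotone test
function. -/
theorem isPositiveTangent_iff {τ : LongRay → ℝ} {a b x : LongRay} (hx : x ∈ Ioo a b)
    (hτ : StrictMonoOn τ (Icc a b)) (hd : MDifferentiableAt 𝓘(ℝ, ℝ) 𝓘(ℝ, ℝ) τ x)
    (h0 : chartDeriv τ x ≠ 0) (w : ℝ) :
    IsPositiveTangent x w ↔ 0 < chartDeriv τ x * w := by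
  have hab : a ≤ b := (hx.1.trans hx.2).le
  constructor
  · intro hpos
    obtain ⟨f, hf, hfd, hfw⟩ := isPositiveTangent_def.1 hpos
    have h := chartDeriv_mul_nonneg hfd hd (by
      filter_upwards [Icc_mem_nhds hx.1 hx.2] with y hy
      obtain hyx | hxy := le_total y x
      · exact mul_nonneg_of_nonpos_of_nonpos (sub_nonpos.2 (hf hyx))
          (sub_nonpos.2 (hτ.monotoneOn hy (Ioo_subset_Icc_self hx) hyx))
      · exact mul_nonneg (sub_nonneg.2 (hf hxy))
          (sub_nonneg.2 (hτ.monotoneOn (Ioo_subset_Icc_self hx) hy hxy)))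
    have hw : w ≠ 0 := by
      rintro rfl
      simp at hfw
    by_contra! hneg
    have h1 : chartDeriv τ x * w < 0 := lt_of_le_of_ne hneg (mul_ne_zero h0 hw)
    nlinarith [mul_neg_of_pos_of_neg hfw h1, mul_nonneg h (mul_self_nonneg w)]
  · intro hw
    let f : LongRay → ℝ := fun y => τ (projIcc a b hab y)
    have hfe : f =ᶠ[𝓝 x] τ := by
      filter_upwards [Icc_mem_nhds hx.1 hx.2] with y hy
      simp only [f, projIcc_of_mem hab hy]
    refine isPositiveTangent_def.2 ⟨f, fun y z hyz => hτ.monotoneOn (Subtype.prop _) (Subtype.prop _)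
      (monotone_projIcc hab hyz), hd.congr_of_eventuallyEq hfe, ?_⟩
    rwa [chartDeriv, chartDerivL, hfe.mfderiv_eq]

variable [IsManifold 𝓘(ℝ, ℝ) 1 LongRay]

theorem mdifferentiableAt_chartAt {x₀ x : LongRay} (hx : x ∈ (chartAt ℝ x₀).source) :
    MDifferentiableAt 𝓘(ℝ, ℝ) 𝓘(ℝ, ℝ) (chartAt ℝ x₀) x :=
  mdifferentiableAt_atlas (chart_mem_atlas ℝ x₀) hx

theorem chartDeriv_chartAt_ne_zero {x₀ x : LongRay} (hx : x ∈ (chartAt ℝ x₀).source) :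
    chartDeriv (chartAt ℝ x₀) x ≠ 0 := by
  have h := isInvertible_mfderiv_extChartAt (I := 𝓘(ℝ, ℝ)) (x := x₀) (y := x) (by simpa using hx)
  have hinj : Function.Injective (chartDerivL (chartAt ℝ x₀) x) := h.bijective.injective
  exact fun h0 => one_ne_zero (hinj (h0.trans (map_zero _).symm))

/-- A tangent vector of the long ray given by its base point and its coordinate. -/
def tangentMk (x : LongRay) (w : ℝ) : LongRayTangent := ⟨x, w⟩

/-- The coordinate of a tangent vector in the preferred chart at its base point. -/
def tangentCoord (p : LongRayTangent) : ℝ := p.2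

theorem trivializationAt_snd (x₀ : LongRay) (p : LongRayTangent)
    (hp : p.1 ∈ (chartAt ℝ x₀).source) :
    (trivializationAt ℝ (TangentSpace 𝓘(ℝ, ℝ)) x₀ p).2 =
      chartDeriv (chartAt ℝ x₀) p.1 * tangentCoord p := by
  have h := TangentBundle.continuousLinearMapAt_trivializationAt (I := 𝓘(ℝ, ℝ)) hp
  have h' : (trivializationAt ℝ (TangentSpace 𝓘(ℝ, ℝ)) x₀).continuousLinearMapAt ℝ p.1 p.2
      = chartDerivL (chartAt ℝ x₀) p.1 (tangentCoord p) :=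
    congrArg (fun L : TangentSpace 𝓘(ℝ, ℝ) p.1 →L[ℝ] ℝ => L p.2) h
  rw [← chartDerivL_apply, ← h']
  exact (Bundle.Trivialization.continuousLinearMapAt_apply_of_mem ℝ _ hp p.2).symm

/-- The preferred chart may jump from point to point, so neither factor need be continuous. The
product is the coordinate of the vector in the fixed chart at `x₀`. -/
theorem continuousOn_chartDeriv_mul (x₀ : LongRay) :
    ContinuousOn (fun p : LongRayTangent => chartDeriv (chartAt ℝ x₀) p.1 * tangentCoord p)
      {p | p.1 ∈ (chartAt ℝ x₀).source} := by
  have h := (trivializationAt ℝ (TangentSpace 𝓘(ℝ, ℝ) (M := LongRay)) x₀).continuousOn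
  exact (continuous_snd.comp_continuousOn (h.mono fun p hp => by
    rw [Bundle.Trivialization.mem_source]
    exact hp)).congr fun p hp => (trivializationAt_snd x₀ p hp).symm

theorem continuousWithinAt_tangent_iff {X : Type*} [TopologicalSpace X] {f : X → LongRayTangent}
    {s : Set X} {z : X} : ContinuousWithinAt f s z ↔
      ContinuousWithinAt (fun y => (f y).1) s z ∧
        ContinuousWithinAt (fun y => chartDeriv (chartAt ℝ (f z).1) (f y).1 * tangentCoord (f y))
          s z := by
  rw [FiberBundle.continuousWithinAt_totalSpace ℝ]
  refine and_congr_right fun hb => ?_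
  have hmem := mem_chart_source ℝ (f z).1
  have hev : ∀ᶠ y in 𝓝[s] z, (f y).1 ∈ (chartAt ℝ (f z).1).source :=
    hb.eventually ((chartAt ℝ (f z).1).open_source.mem_nhds hmem)
  have hform := trivializationAt_snd (f z).1
  exact ⟨fun h => h.congr_of_eventuallyEq (hev.mono fun y hy => (hform _ hy).symm) (hform _ hmem).symm,
    fun h => h.congr_of_eventuallyEq (hev.mono fun y hy => hform _ hy) (hform _ hmem)⟩

theorem exists_coordinate (x₀ : LongRay) : ∃ a b : LongRay, a < x₀ ∧ x₀ < b ∧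
    Icc a b ⊆ (chartAt ℝ x₀).source ∧
    ∃ s : ℝ, s ≠ 0 ∧ StrictMonoOn (fun x => s * chartAt ℝ x₀ x) (Icc a b) := by
  obtain ⟨a, b, hab, hsub⟩ := (mem_nhds_iff_exists_Ioo_subset).1
    ((chartAt ℝ x₀).open_source.mem_nhds (mem_chart_source ℝ x₀))
  obtain ⟨a', ha, ha'⟩ := exists_between hab.1
  obtain ⟨b', hb', hb⟩ := exists_between hab.2
  have hs : Icc a' b' ⊆ (chartAt ℝ x₀).source :=
    (Icc_subset_Ioo ha hb).trans hsub
  refine ⟨a', b', ha', hb', hs, ?_⟩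
  obtain h | h := strictMonoOn_or_strictAntiOn (ha'.trans hb').le
    (fun x hx => mdifferentiableAt_chartAt (hs hx)) fun x hx => chartDeriv_chartAt_ne_zero (hs hx)
  · exact ⟨1, one_ne_zero, fun x hx y hy hxy => by simpa using h hx hy hxy⟩
  · exact ⟨-1, by norm_num, fun x hx y hy hxy => by simpa using h hx hy hxy⟩

end LongRay

/-! ### Maps on positive vectors are constant over clubs. -/

namespace LongRay

variable [ChartedSpace ℝ LongRay]

/-- The points `y` for which a strictly increasing coordinate on `(a, y]` has its coordinate vector
field in `U`. -/
def Reaches (U : Set LongRayTangent) (a : LongRay) : Set LongRay :=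
  {y | a < y ∧ ∃ τ : LongRay → ℝ, StrictMonoOn τ (Ioc a y) ∧ ∀ x ∈ Ioc a y,
    MDifferentiableAt 𝓘(ℝ, ℝ) 𝓘(ℝ, ℝ) τ x ∧ chartDeriv τ x ≠ 0 ∧
      tangentMk x (chartDeriv τ x)⁻¹ ∈ U}

theorem reaches_of_le {U : Set LongRayTangent} {a a' y : LongRay} (h : y ∈ Reaches U a)
    (ha : a ≤ a') (hy : a' < y) : y ∈ Reaches U a' := by
  obtain ⟨-, τ, hτ, hU⟩ := h
  exact ⟨hy, τ, hτ.mono (Ioc_subset_Ioc_left ha), fun x hx => hU x (Ioc_subset_Ioc_left ha hx)⟩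

theorem unbounded_reaches_mono {U : Set LongRayTangent} {a a' : LongRay}
    (h : Unbounded (Reaches U a)) (ha : a ≤ a') : Unbounded (Reaches U a') :=
  (h.inter_Ioi a').mono fun _ hy => reaches_of_le hy.1 ha hy.2

/-- Vector fields avoiding each other cannot both have unboundedly many long integral curves. -/
theorem not_unbounded_reaches {U V : Set LongRayTangent} (hUV : Disjoint U V) {a : LongRay}
    (hU : Unbounded (Reaches U a)) (hV : Unbounded (Reaches V a)) : False := by
  have hex : ∀ (W : Set LongRayTangent) (y : LongRay), ∃ τ : LongRay → ℝ, y ∈ Reaches W a →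
      StrictMonoOn τ (Ioc a y) ∧ ∀ x ∈ Ioc a y, MDifferentiableAt 𝓘(ℝ, ℝ) 𝓘(ℝ, ℝ) τ x ∧
        chartDeriv τ x ≠ 0 ∧ tangentMk x (chartDeriv τ x)⁻¹ ∈ W := by
    intro W y
    by_cases hy : y ∈ Reaches W a
    · obtain ⟨-, τ, hτ⟩ := hy
      exact ⟨τ, fun _ => hτ⟩
    · exact ⟨fun _ => 0, fun h => absurd h hy⟩
  choose τ hτ using hex U
  choose τ' hτ' using hex V
  obtain ⟨x₀, hx₀⟩ := exists_gt a
  obtain ⟨x₁, hx₁⟩ := exists_gt x₀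
  -- Equal derivatives at a point would give the same tangent vector in `U` and in `V`.
  have key : ∀ y ∈ Reaches U a, ∀ z ∈ Reaches V a, x₁ < y → x₁ < z →
      StrictMonoOn (fun x => τ' z x - τ y x) (Icc x₀ (min y z)) ∨
        StrictAntiOn (fun x => τ' z x - τ y x) (Icc x₀ (min y z)) := by
    intro y hy z hz hxy hxz
    have hIy : ∀ x ∈ Icc x₀ (min y z), x ∈ Ioc a y := fun x hx =>
      ⟨hx₀.trans_le hx.1, hx.2.trans (min_le_left _ _)⟩
    have hIz : ∀ x ∈ Icc x₀ (min y z), x ∈ Ioc a z := fun x hx =>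
      ⟨hx₀.trans_le hx.1, hx.2.trans (min_le_right _ _)⟩
    refine strictMonoOn_or_strictAntiOn (hx₁.trans (lt_min hxy hxz)).le (fun x hx => ?_)
      fun x hx => ?_
    · exact ((hτ' z hz).2 x (hIz x hx)).1.sub_real ((hτ y hy).2 x (hIy x hx)).1
    · have h1 := (hτ y hy).2 x (hIy x hx)
      have h2 := (hτ' z hz).2 x (hIz x hx)
      rw [chartDeriv_sub h2.1 h1.1]
      intro h0
      refine hUV.le_bot ⟨h1.2.2, ?_⟩
      rw [← sub_eq_zero.1 h0]
      exact h2.2.2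
  have hm0 : ∀ {y z : LongRay}, x₁ < y → x₁ < z → x₀ ∈ Icc x₀ (min y z) := fun h h' =>
    ⟨le_rfl, (hx₁.trans (lt_min h h')).le⟩
  have hm1 : ∀ {y z : LongRay}, x₁ < y → x₁ < z → x₁ ∈ Icc x₀ (min y z) := fun h h' =>
    ⟨hx₁.le, (lt_min h h').le⟩
  have hmono : ∀ {τ : LongRay → ℝ} {y : LongRay}, StrictMonoOn τ (Ioc a y) →
      StrictMonoOn τ (Icc x₀ y) := fun h => h.mono fun x hx => ⟨hx₀.trans_le hx.1, hx.2⟩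
  -- The increments over [x₀, x₁] tell in which direction the difference is monotone. Separating
  -- them by `r` makes the direction the same for all pairs of the two subfamilies.
  obtain ⟨r, ⟨h1, h2⟩ | ⟨h1, h2⟩⟩ := exists_separating_real hU hV (fun y => τ y x₁ - τ y x₀)
    (fun z => τ' z x₁ - τ' z x₀) ⟨x₁, fun y hy z hz hxy hxz he => by
      have he' : τ' z x₀ - τ y x₀ = τ' z x₁ - τ y x₁ := by linarith
      obtain h | h := key y hy z hz hxy hxz
      · exact (h (hm0 hxy hxz) (hm1 hxy hxz) hx₁).ne he'
      · exact (h (hm0 hxy hxz) (hm1 hxy hxz) hx₁).ne' he'⟩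
  · refine not_dominated_families (h2.inter_Ioi x₁) (h1.inter_Ioi x₁) x₀ τ' τ
      (fun z hz => hmono (hτ z hz.1.1).1) ?_
    rintro z ⟨⟨hz, hzr⟩, hxz⟩ y ⟨⟨hy, hyr⟩, hxy⟩ x x' h0 hxx hxz' hxy'
    obtain h | h := key y hy z hz hxy hxz
    · have := h.monotoneOn ⟨h0, hxx.trans (le_min hxy' hxz')⟩ ⟨h0.trans hxx, le_min hxy' hxz'⟩ hxx
      beta_reduce at this
      linarith
    · have := h (hm0 hxy hxz) (hm1 hxy hxz) hx₁
      beta_reduce at this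
      linarith
  · refine not_dominated_families (h1.inter_Ioi x₁) (h2.inter_Ioi x₁) x₀ τ τ'
      (fun z hz => hmono (hτ' z hz.1.1).1) ?_
    rintro y ⟨⟨hy, hyr⟩, hxy⟩ z ⟨⟨hz, hzr⟩, hxz⟩ x x' h0 hxx hxy' hxz'
    obtain h | h := key y hy z hz hxy hxz
    · have := h (hm0 hxy hxz) (hm1 hxy hxz) hx₁
      beta_reduce at this
      linarith
    · have := h.antitoneOn ⟨h0, hxx.trans (le_min hxy' hxz')⟩ ⟨h0.trans hxx, le_min hxy' hxz'⟩ hxx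
      beta_reduce at this
      linarith

variable [IsManifold 𝓘(ℝ, ℝ) 1 LongRay]

theorem continuousAt_positiveTangent_iff {X : Type*} [TopologicalSpace X] {f : X → PositiveTangent}
    {z : X} : ContinuousAt f z ↔ ContinuousAt (fun y => (f y).1) z :=
  IsInducing.subtypeVal.continuousAt_iff

/-- The coordinate field of the chart at the base point, rescaled, passes through `p` and is
constant in the trivialization. It is thus continuous and stays in `U` slightly to the left. -/
theorem exists_mem_reaches {U : Set PositiveTangent} (hU : IsOpen U) {p : PositiveTangent}
    (hp : p ∈ U) : ∃ a < p.proj, ∀ a', a ≤ a' → a' < p.proj →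
      p.proj ∈ Reaches (Subtype.val '' U) a' := by
  obtain ⟨⟨x₀, w⟩, hpos⟩ := p
  change ∃ a < x₀, ∀ a', a ≤ a' → a' < x₀ → x₀ ∈ Reaches (Subtype.val '' U) a'
  change ℝ at w
  change IsPositiveTangent x₀ w at hpos
  obtain ⟨a, b, ha, hb, hsrc, s, hs, hmono⟩ := exists_coordinate x₀
  have hD : ∀ x ∈ Icc a b, chartDeriv (chartAt ℝ x₀) x ≠ 0 := fun x hx =>
    chartDeriv_chartAt_ne_zero (hsrc hx)
  have hMs : ∀ (c : ℝ), ∀ x ∈ Icc a b,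
      MDifferentiableAt 𝓘(ℝ, ℝ) 𝓘(ℝ, ℝ) (fun y => c * chartAt ℝ x₀ y) x := fun c x hx =>
    mdifferentiableAt_const_mul c (mdifferentiableAt_chartAt (hsrc hx))
  have hMd : ∀ (c : ℝ), ∀ x ∈ Icc a b,
      chartDeriv (fun y => c * chartAt ℝ x₀ y) x = c * chartDeriv (chartAt ℝ x₀) x := fun c x hx =>
    chartDeriv_const_mul c (mdifferentiableAt_chartAt (hsrc hx))
  have hx₀ : x₀ ∈ Icc a b := ⟨ha.le, hb.le⟩
  have hw := (isPositiveTangent_iff ⟨ha, hb⟩ hmono (hMs s x₀ hx₀)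
    (by rw [hMd s x₀ hx₀]; exact mul_ne_zero hs (hD x₀ hx₀)) w).1 hpos
  rw [hMd s x₀ hx₀] at hw
  -- Here `c` is the coordinate of the given vector in the chart. Division by it turns the chart
  -- into an increasing coordinate whose field takes the value `w` at `x₀`.
  obtain ⟨c, hc⟩ : ∃ c, c = chartDeriv (chartAt ℝ x₀) x₀ * w := ⟨_, rfl⟩
  have hsc : 0 < s * c := by rwa [hc, ← mul_assoc]
  have hc0 : c ≠ 0 := fun h => by simp [h] at hsc
  have hτ : StrictMonoOn (fun y => c⁻¹ * chartAt ℝ x₀ y) (Icc a b) := by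
    intro x hx y hy hxy
    have h1 := mul_lt_mul_of_pos_left (hmono hx hy hxy) (inv_pos.2 hsc)
    simp only at h1 ⊢
    have hs' : (s * c)⁻¹ * s = c⁻¹ := by rw [mul_inv, mul_right_comm, inv_mul_cancel₀ hs, one_mul]
    rwa [← mul_assoc, ← mul_assoc, hs'] at h1
  have hτ0 : ∀ x ∈ Icc a b, chartDeriv (fun y => c⁻¹ * chartAt ℝ x₀ y) x ≠ 0 := fun x hx => by
    rw [hMd _ x hx]
    exact mul_ne_zero (inv_ne_zero hc0) (hD x hx)
  have hpos' : ∀ x ∈ Ioo a b,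
      IsPositiveTangent x ((chartDeriv (fun y => c⁻¹ * chartAt ℝ x₀ y) x)⁻¹ : ℝ) := fun x hx => by
    have hx' := Ioo_subset_Icc_self hx
    refine (isPositiveTangent_iff hx hτ (hMs _ x hx') (hτ0 x hx') _).2 ?_
    rw [mul_inv_cancel₀ (hτ0 x hx')]
    exact one_pos
  let σ : Ioo a b → PositiveTangent := fun x =>
    ⟨tangentMk x (chartDeriv (fun y => c⁻¹ * chartAt ℝ x₀ y) x)⁻¹, hpos' x x.2⟩
  have hI₀ : x₀ ∈ Ioo a b := ⟨ha, hb⟩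
  have hσ₀ : σ ⟨x₀, hI₀⟩ = ⟨⟨x₀, w⟩, hpos⟩ := by
    refine Subtype.ext ?_
    change tangentMk x₀ _ = tangentMk x₀ w
    congr 1
    rw [hMd _ x₀ hx₀, mul_inv, inv_inv, hc, mul_right_comm, mul_inv_cancel₀ (hD x₀ hx₀), one_mul]
  have hσ : ContinuousAt σ ⟨x₀, hI₀⟩ := by
    rw [continuousAt_positiveTangent_iff, ← continuousWithinAt_univ, continuousWithinAt_tangent_iff]
    refine ⟨continuous_subtype_val.continuousWithinAt, ?_⟩
    refine ContinuousWithinAt.congr (f := fun _ => c) continuousWithinAt_const ?_ ?_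
    · rintro ⟨x, hx⟩ -
      have hx' := Ioo_subset_Icc_self hx
      change chartDeriv (chartAt ℝ x₀) x * (chartDeriv (fun y => c⁻¹ * chartAt ℝ x₀ y) x)⁻¹ = c
      rw [hMd _ x hx', mul_inv, inv_inv, mul_left_comm, mul_inv_cancel₀ (hD x hx'), mul_one]
    · change chartDeriv (chartAt ℝ x₀) x₀ * (chartDeriv (fun y => c⁻¹ * chartAt ℝ x₀ y) x₀)⁻¹ = c
      rw [hMd _ x₀ hx₀, mul_inv, inv_inv, mul_left_comm, mul_inv_cancel₀ (hD x₀ hx₀), mul_one]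
  have hn : σ ⁻¹' U ∈ 𝓝 (⟨x₀, hI₀⟩ : Ioo a b) := hσ (by rw [hσ₀]; exact hU.mem_nhds hp)
  rw [nhds_subtype_eq_comap, mem_comap] at hn
  obtain ⟨N, hN, hNU⟩ := hn
  obtain ⟨a', b', hab', hsub⟩ := mem_nhds_iff_exists_Ioo_subset.1 hN
  obtain ⟨l, hl, hl'⟩ := exists_between (max_lt ha hab'.1)
  refine ⟨l, hl', fun d hld hd => ⟨hd, fun y => c⁻¹ * chartAt ℝ x₀ y, hτ.mono fun x hx => ?_,
    fun x hx => ?_⟩⟩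
  · exact ⟨((le_max_left _ _).trans_lt hl).le.trans (hld.trans hx.1.le), hx.2.trans hb.le⟩
  · have hxI : x ∈ Ioo a b :=
      ⟨((le_max_left _ _).trans_lt hl).trans_le (hld.trans hx.1.le), hx.2.trans_lt hb⟩
    have hx' := Ioo_subset_Icc_self hxI
    refine ⟨hMs _ x hx', hτ0 x hx', σ ⟨x, hxI⟩, hNU (a := ⟨x, hxI⟩) (hsub ?_), rfl⟩
    exact ⟨((le_max_right _ _).trans_lt hl).trans_le (hld.trans hx.1.le), hx.2.trans_lt hab'.2⟩

/-- A positive tangent vector lies over a set of countable ordinals. -/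
def LiesOver (p : PositiveTangent) (C : Set OmegaOne) : Prop :=
  ∃ α ∈ C, p.proj.1 = ClosedLongRay.ofOrdinal α

/-- Over a point of the club, a vector of `U j` yields a field on an interval ending beyond the
bound attached to its start. By the choice of the bound, `U j` then has such fields of unbounded
length, which is impossible for two disjoint sets. -/
theorem exists_club_of_disjoint {J : Type*} [Countable J] (U : J → Set PositiveTangent)
    (hU : ∀ j, IsOpen (U j)) : ∃ C : Set OmegaOne, IsClub C ∧ ∀ j k, Disjoint (U j) (U k) →
      ∀ p p', LiesOver p C → LiesOver p' C → p ∈ U j → p' ∉ U k := by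
  have hP : ∀ γ : OmegaOne, ∃ x : LongRay, idx x = γ := fun γ =>
    (exists_mk γ (1 / 2) (by norm_num) (by norm_num) (Or.inr (by norm_num))).imp fun _ h => h.1
  choose P hP using hP
  have hB : ∀ γ, ∃ B, ∀ j, ∀ y ∈ Reaches (Subtype.val '' U j) (P γ), B < y →
      Unbounded (Reaches (Subtype.val '' U j) (P γ)) := fun γ => exists_bound_of_countable _
  choose B hB using hB
  -- Closure under `b` makes δ exceed both a start `P γ` above `a` and the bound `B γ` for that
  -- start.
  choose b hb using fun γ => exists_gt (max γ (idx (B γ)))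
  refine ⟨_, OmegaOne.isClub_closurePoints b, ?_⟩
  have key : ∀ j p, LiesOver p {δ : OmegaOne | (∃ γ, γ < δ) ∧ ∀ γ < δ, b γ < δ} → p ∈ U j →
      ∃ γ, ∀ γ' > γ, Unbounded (Reaches (Subtype.val '' U j) (P γ')) := by
    rintro j p ⟨δ, ⟨-, hδ⟩, hpδ⟩ hpU
    have hidx : idx p.proj = δ := congrArg
      (fun x : ClosedLongRay => (ofLex (α := OmegaOne × Ico (0 : ℝ) 1) x).1) hpδ
    have hfrac : frac p.proj = 0 := congrArg
      (fun x : ClosedLongRay => ((ofLex (α := OmegaOne × Ico (0 : ℝ) 1) x).2 : ℝ)) hpδ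
    obtain ⟨a, ha, har⟩ := exists_mem_reaches (hU j) hpU
    have haδ : idx a < δ := by
      obtain h | ⟨-, h⟩ := lt_iff.1 ha
      · rwa [hidx] at h
      · exact absurd (frac_nonneg a) (not_le.2 (hfrac ▸ h))
    have hlt : idx a < b (idx a) := (le_max_left _ _).trans_lt (hb _)
    have hlt' : b (idx a) < δ := hδ _ haδ
    refine ⟨b (idx a), fun γ' hγ' => unbounded_reaches_mono (a := P (b (idx a))) ?_
      (lt_iff.2 (Or.inl (by rwa [hP, hP]))).le⟩
    refine hB _ j p.proj (har _ (lt_iff.2 (Or.inl (by rwa [hP]))).le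
      (lt_iff.2 (Or.inl (by rwa [hP, hidx])))) (lt_iff.2 (Or.inl ?_))
    rw [hidx]
    exact ((le_max_right _ _).trans_lt (hb _)).trans (hδ _ hlt')
  intro j k hjk p p' hp hp' hpj hpk
  obtain ⟨γ, hγ⟩ := key j p hp hpj
  obtain ⟨γ', hγ'⟩ := key k p' hp' hpk
  obtain ⟨γ'', h⟩ := exists_gt (max γ γ')
  exact not_unbounded_reaches ((disjoint_image_iff Subtype.val_injective).2 hjk)
    (hγ γ'' ((le_max_left _ _).trans_lt h)) (hγ' γ'' ((le_max_right _ _).trans_lt h))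

/-- Countably many continuous functions to a second countable Hausdorff space are constant over a
common club. -/
theorem exists_club_const {ι Y : Type*} [Countable ι] [TopologicalSpace Y] [T2Space Y]
    [SecondCountableTopology Y] (f : ι → C(PositiveTangent, Y)) :
    ∃ C : Set OmegaOne, IsClub C ∧ ∀ i p p', LiesOver p C → LiesOver p' C → f i p = f i p' := by
  have : Countable (TopologicalSpace.countableBasis Y) :=
    (TopologicalSpace.countable_countableBasis Y).to_subtype
  have hbasis := TopologicalSpace.isBasis_countableBasis Y
  -- Indexing by all pairs of a function and a basic open set yields one club for the whole family.
  obtain ⟨C, hC, h⟩ := exists_club_of_disjoint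
    (fun j : ι × TopologicalSpace.countableBasis Y => f j.1 ⁻¹' j.2)
    fun j => (hbasis.isOpen j.2.2).preimage (f j.1).continuous
  refine ⟨C, hC, fun i p p' hp hp' => ?_⟩
  by_contra hne
  obtain ⟨u, v, hu, hv, hpu, hpv, huv⟩ := t2_separation hne
  obtain ⟨u', hu', hpu', huu⟩ := hbasis.exists_subset_of_mem_open hpu hu
  obtain ⟨v', hv', hpv', hvv⟩ := hbasis.exists_subset_of_mem_open hpv hv
  exact h (i, ⟨u', hu'⟩) (i, ⟨v', hv'⟩) ((huv.mono huu hvv).preimage _) p p' hp hp' hpu' hpv'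

/-- Every nonzero countable ordinal carries a positive tangent vector. -/
theorem exists_liesOver {C : Set OmegaOne} {α β : OmegaOne} (hα : α ∈ C) (hβ : β < α) :
    ∃ p : PositiveTangent, LiesOver p C ∧ p.proj.1 = ClosedLongRay.ofOrdinal α := by
  let x : LongRay := ⟨ClosedLongRay.ofOrdinal α, not_isMin_iff.2
    ⟨ClosedLongRay.ofOrdinal β, Prod.Lex.lt_iff.2 (Or.inl hβ)⟩⟩
  obtain ⟨a, b, ha, hb, hsrc, s, hs, hmono⟩ := exists_coordinate x
  have hx := hsrc ⟨ha.le, hb.le⟩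
  have hd := mdifferentiableAt_chartAt hx
  have h0 : chartDeriv (fun y => s * chartAt ℝ x y) x ≠ 0 := by
    rw [chartDeriv_const_mul s hd]
    exact mul_ne_zero hs (chartDeriv_chartAt_ne_zero hx)
  refine ⟨⟨tangentMk x (chartDeriv (fun y => s * chartAt ℝ x y) x), ?_⟩, ⟨α, hα, rfl⟩, rfl⟩
  exact (isPositiveTangent_iff ⟨ha, hb⟩ hmono (mdifferentiableAt_const_mul s hd) h0 _).2
    (mul_self_pos.2 h0)

end LongRay

/-! ### Homotopies of maps from positive vectors to the long ray. -/

namespace LongRay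

theorem exists_idx_lt_of_isLindelof {s : Set LongRay} (hs : IsLindelof s) :
    ∃ α : OmegaOne, ∀ x ∈ s, idx x < α := by
  obtain ⟨r, hr, hsub⟩ := hs.elim_countable_subcover (fun b : LongRay => Iio b)
    (fun _ => isOpen_Iio) fun x _ => by
      obtain ⟨b, hb⟩ := exists_gt x
      exact mem_iUnion.2 ⟨b, hb⟩
  obtain ⟨b, hb⟩ := exists_gt_of_countable hr
  obtain ⟨α, hα⟩ := exists_gt (idx b)
  refine ⟨α, fun x hx => ?_⟩
  obtain ⟨c, hc, hxc⟩ := mem_iUnion₂.1 (hsub hx)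
  exact (idx_mono ((mem_Iio.1 hxc).trans (hb c hc)).le).trans_lt hα

theorem exists_lt_mem_isClub {C : Set OmegaOne} (hC : IsClub C) (β : OmegaOne) :
    ∃ α ∈ C, β < α := by
  obtain ⟨γ, hγ⟩ := exists_gt β
  obtain ⟨α, hα, hγα⟩ := hC.isCofinal γ
  exact ⟨α, hα, hγ.trans_le hγα⟩

variable [ChartedSpace ℝ LongRay]

theorem LiesOver.mono {p : PositiveTangent} {C C' : Set OmegaOne} (h : LiesOver p C)
    (hC : C ⊆ C') : LiesOver p C' :=
  h.imp fun _ hα => ⟨hC hα.1, hα.2⟩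

variable [IsManifold 𝓘(ℝ, ℝ) 1 LongRay]

theorem exists_liesOver_of_isClub {C : Set OmegaOne} (hC : IsClub C) :
    ∃ p : PositiveTangent, LiesOver p C := by
  obtain ⟨β⟩ := (inferInstance : Nonempty OmegaOne)
  obtain ⟨α, hα, hβ⟩ := exists_lt_mem_isClub hC β
  exact (exists_liesOver hα hβ).imp fun _ h => h.1

theorem almostConstant_of_isLindelof (h : C(PositiveTangent × unitInterval, LongRay))
    (t₀ : unitInterval) (ht₀ : IsLindelof (range fun p : PositiveTangent => h (p, t₀)))
    (t : unitInterval) : AlmostConstant fun p : PositiveTangent => h (p, t) := by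
  -- Currying handles all times at once, since C([0,1], ℝ) is second countable and Hausdorff.
  let F : OmegaOne → C(PositiveTangent, C(unitInterval, ℝ)) := fun α =>
    ContinuousMap.curry ⟨fun q => climb α (h q), (continuous_climb α).comp h.continuous⟩
  have hclub : ∀ α : OmegaOne, ∃ C : Set OmegaOne, IsClub C ∧ ∀ β ≤ α, ∀ p p', LiesOver p C →
      LiesOver p' C → ∀ t, climb β (h (p, t)) = climb β (h (p', t)) := fun α => by
    have : Countable (Iic α) := (OmegaOne.countable_Iic α).to_subtype
    obtain ⟨C, hC, hconst⟩ := exists_club_const fun β : Iic α => F β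
    exact ⟨C, hC, fun β hβ p p' hp hp' t =>
      congrArg (fun u : C(unitInterval, ℝ) => u t) (hconst ⟨β, hβ⟩ p p' hp hp')⟩
  choose C hC hconst using hclub
  choose p hp using fun α => exists_liesOver_of_isClub (hC α)
  let A : OmegaOne → Set unitInterval := fun α => {t | climb α (h (p α, t)) < 1}
  have hAo : ∀ α, IsOpen (A α) := fun α => isOpen_lt
    ((continuous_climb α).comp (h.continuous.comp (Continuous.prodMk_right _))) continuous_const
  -- Countably many `A α` already cover the union, so one `β` lies above all their indices. At each
  -- time of the union the truncation at `β` vanishes over the club, a closed condition.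
  obtain ⟨T, hT, hTA⟩ := TopologicalSpace.isOpen_iUnion_countable A hAo
  obtain ⟨β, hβ⟩ := OmegaOne.exists_gt_of_countable hT
  have hAβ : (⋃ α, A α) = {t | climb β (h (p β, t)) = 0} := by
    refine Subset.antisymm (fun s hs => ?_) fun s hs => ?_
    · rw [← hTA] at hs
      obtain ⟨α, hα, hs⟩ := mem_iUnion₂.1 hs
      -- A vector over both clubs transfers information between the truncations at `α` and `β`.
      obtain ⟨q, hq⟩ := exists_liesOver_of_isClub ((hC α).inter OmegaOne.cof_ne (hC β))
      have h1 : climb α (h (q, s)) < 1 := by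
        rwa [hconst α α le_rfl q (p α) (hq.mono inter_subset_left) (hp α)]
      have h2 : climb β (h (q, s)) = 0 :=
        climb_of_lt ((idx_le_of_climb_lt_one h1).trans_lt (hβ α hα))
      rwa [hconst β β le_rfl q (p β) (hq.mono inter_subset_right) (hp β)] at h2
    · refine mem_iUnion.2 ⟨β, ?_⟩
      change climb β (h (p β, s)) < 1
      rw [show climb β (h (p β, s)) = 0 from hs]
      exact one_pos
  have hclopen : IsClopen (⋃ α, A α) := by
    refine ⟨?_, isOpen_iUnion hAo⟩
    rw [hAβ]
    exact isClosed_eq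
      ((continuous_climb β).comp (h.continuous.comp (Continuous.prodMk_right _))) continuous_const
  have huniv : (⋃ α, A α) = univ := by
    refine hclopen.eq_univ ?_
    obtain ⟨α, hα⟩ := exists_idx_lt_of_isLindelof ht₀
    refine ⟨t₀, mem_iUnion.2 ⟨α, ?_⟩⟩
    change climb α (h (p α, t₀)) < 1
    rw [climb_of_lt (hα _ ⟨p α, rfl⟩)]
    exact one_pos
  have hidx : ∀ q, LiesOver q (C β) → idx (h (q, t)) ≤ β := by
    intro q hq
    have ht : climb β (h (p β, t)) = 0 := by
      have : t ∈ ⋃ α, A α := huniv ▸ mem_univ t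
      rwa [hAβ] at this
    refine idx_le_of_climb_lt_one ?_
    rw [hconst β β le_rfl q (p β) hq (hp β), ht]
    exact one_pos
  exact ⟨C β, hC β, h (p β, t), fun q hq => eq_of_climb_eq (hidx q hq) (hidx _ (hp β))
    fun γ hγ => hconst β γ hγ q (p β) hq (hp β) t⟩

theorem continuous_proj : Continuous PositiveTangent.proj :=
  (FiberBundle.continuous_proj ℝ (TangentSpace 𝓘(ℝ, ℝ) (M := LongRay))).comp continuous_subtype_val

/-- The bundle projection of the positive tangent vectors is not homotopic to a constant. -/
theorem not_proj_nullhomotopic :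
    ¬ (⟨PositiveTangent.proj, continuous_proj⟩ : C(PositiveTangent, LongRay)).Nullhomotopic := by
  rintro ⟨c, ⟨H⟩⟩
  obtain ⟨C, hC, y, hy⟩ := almostConstant_of_isLindelof
    (H.toContinuousMap.comp ⟨Prod.swap, continuous_swap⟩) 1 (by
      have : (range fun p : PositiveTangent =>
          (H.toContinuousMap.comp ⟨Prod.swap, continuous_swap⟩) (p, 1)) ⊆ {c} := by
        rintro _ ⟨p, rfl⟩
        exact H.apply_one p
      exact (countable_singleton c).mono this |>.isLindelof) 0
  have hproj : ∀ p, LiesOver p C → p.proj = y := fun p hp => by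
    have h0 : H (0, p) = p.proj := H.apply_zero p
    rw [← h0]
    exact hy p hp
  obtain ⟨β⟩ := (inferInstance : Nonempty OmegaOne)
  obtain ⟨α, hα, hβ⟩ := exists_lt_mem_isClub hC β
  obtain ⟨α', hα', hαα⟩ := exists_lt_mem_isClub hC α
  obtain ⟨p, hp, hpα⟩ := exists_liesOver hα hβ
  obtain ⟨p', hp', hpα'⟩ := exists_liesOver hα' hαα
  have he : ClosedLongRay.ofOrdinal α = ClosedLongRay.ofOrdinal α' := by
    rw [← hpα, ← hpα', hproj p hp, hproj p' hp']
  exact hαα.ne (congrArg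
    (fun x : ClosedLongRay => (ofLex (α := OmegaOne × Ico (0 : ℝ) 1) x).1) he)

theorem not_contractibleSpace_positiveTangent : ¬ ContractibleSpace PositiveTangent := fun _ =>
  not_proj_nullhomotopic ((id_nullhomotopic PositiveTangent).comp_right
    ⟨PositiveTangent.proj, continuous_proj⟩)

/-- The projection of T⁺ factors through TL⁺, so contracting TL⁺ would already make it
nullhomotopic. -/
theorem not_contractibleSpace_tangent : ¬ ContractibleSpace LongRayTangent := fun _ =>
  not_proj_nullhomotopic (((id_nullhomotopic LongRayTangent).comp_right
    ⟨Bundle.TotalSpace.proj, FiberBundle.continuous_proj ℝ (TangentSpace 𝓘(ℝ, ℝ) (M := LongRay))⟩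
      ).comp_left ⟨Subtype.val, continuous_subtype_val⟩)

end LongRay

/-! ### Extension from closed sets and maps from CW-complexes. -/

/-- Continuous maps to `X` extend from closed subsets of compact Hausdorff spaces. -/
def CompactExtension (X : Type*) [TopologicalSpace X] : Prop :=
  ∀ (K : Type) [TopologicalSpace K] [CompactSpace K] [T2Space K] (A : Set K), IsClosed A →
    ∀ f : C(A, X), ∃ F : C(K, X), ∀ a : A, F a = f a

namespace CompactExtension

theorem exists_extension {X : Type*} [TopologicalSpace X] (hX : CompactExtension X) {K : Type}
    [TopologicalSpace K] [CompactSpace K] [T2Space K] {A : Set K} (hA : IsClosed A) {f : K → X}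
    (hf : ContinuousOn f A) : ∃ F : C(K, X), EqOn F f A := by
  obtain ⟨F, hF⟩ := hX K A hA ⟨A.domRestrict f, continuousOn_iff_continuous_domRestrict.1 hf⟩
  exact ⟨F, fun a ha => hF ⟨a, ha⟩⟩

theorem nonempty {X : Type*} [TopologicalSpace X] (hX : CompactExtension X) : Nonempty X := by
  obtain ⟨F, -⟩ := hX Unit ∅ isClosed_empty ⟨fun a => a.2.elim, continuous_of_const
    fun a => a.2.elim⟩
  exact ⟨F ()⟩

-- The data prescribe a map on the sides, bottom and top of the closed cylinder over the ball, to
-- which the extension property applies.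
open Metric in
theorem exists_path_extension {X : Type*} [TopologicalSpace X] (hX : CompactExtension X) {n : ℕ}
    {H : (Fin n → ℝ) → C(unitInterval, X)} (hH : ContinuousOn H (sphere 0 1))
    {g : (Fin n → ℝ) → X} (hg : ContinuousOn g (closedBall 0 1)) (x₀ : X)
    (hH0 : ∀ z ∈ sphere 0 1, H z 0 = g z) (hH1 : ∀ z ∈ sphere 0 1, H z 1 = x₀) :
    ∃ F : (Fin n → ℝ) → C(unitInterval, X), ContinuousOn F (closedBall 0 1) ∧
      EqOn F H (sphere 0 1) ∧ ∀ z ∈ closedBall 0 1, F z 0 = g z ∧ F z 1 = x₀ := by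
  classical
  have : CompactSpace (closedBall (0 : Fin n → ℝ) 1) :=
    isCompact_iff_compactSpace.1 (isCompact_closedBall _ _)
  let K := closedBall (0 : Fin n → ℝ) 1 × unitInterval
  let A₁ : Set K := {q | (q.1 : Fin n → ℝ) ∈ sphere 0 1}
  let A₂ : Set K := {q | q.2 = 0}
  let A₃ : Set K := {q | q.2 = 1}
  have h1 : IsClosed A₁ := isClosed_sphere.preimage (continuous_subtype_val.comp continuous_fst)
  have h2 : IsClosed A₂ := isClosed_eq continuous_snd continuous_const
  have h3 : IsClosed A₃ := isClosed_eq continuous_snd continuous_const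
  let k : K → X := fun q => if (q.1 : Fin n → ℝ) ∈ sphere 0 1 then H q.1 q.2
    else if q.2 = 0 then g q.1 else x₀
  have hk1 : EqOn k (fun q => H q.1 q.2) A₁ := fun q hq => if_pos hq
  have hk2 : EqOn k (fun q => g q.1) A₂ := fun q hq => by
    by_cases hs : (q.1 : Fin n → ℝ) ∈ sphere 0 1
    · have h := hH0 _ hs
      rw [← show q.2 = 0 from hq] at h
      exact (hk1 hs).trans h
    · simp only [k, if_neg hs, if_pos (show q.2 = 0 from hq)]
  have hk3 : EqOn k (fun q => x₀) A₃ := fun q hq => by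
    by_cases hs : (q.1 : Fin n → ℝ) ∈ sphere 0 1
    · have h := hH1 _ hs
      rw [← show q.2 = 1 from hq] at h
      exact (hk1 hs).trans h
    · have h0 : q.2 ≠ 0 := by
        rw [show q.2 = 1 from hq]
        exact one_ne_zero
      simp only [k, if_neg hs, if_neg h0]
  have hkc : ContinuousOn k (A₁ ∪ A₂ ∪ A₃) := by
    refine ContinuousOn.union_of_isClosed (ContinuousOn.union_of_isClosed ?_ ?_ h1 h2) ?_
      (h1.union h2) h3
    · refine ContinuousOn.congr ?_ hk1
      have hc : ContinuousOn (fun q : K => (H q.1, q.2)) A₁ :=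
        (hH.comp (continuous_subtype_val.comp continuous_fst).continuousOn fun q hq => hq).prodMk
          continuous_snd.continuousOn
      exact (continuous_eval (F := C(unitInterval, X))).comp_continuousOn hc
    · exact ((hg.comp (continuous_subtype_val.comp continuous_fst).continuousOn
        fun q _ => q.1.2)).congr hk2
    · exact continuousOn_const.congr hk3
  obtain ⟨F, hF⟩ := hX.exists_extension ((h1.union h2).union h3) hkc
  let G : C(closedBall (0 : Fin n → ℝ) 1, C(unitInterval, X)) := ContinuousMap.curry F
  let F' : (Fin n → ℝ) → C(unitInterval, X) := fun z =>
    if hz : z ∈ closedBall 0 1 then G ⟨z, hz⟩ else ContinuousMap.const _ x₀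
  have hF' : ∀ (z) (hz : z ∈ closedBall (0 : Fin n → ℝ) 1) (t), F' z t = F (⟨z, hz⟩, t) := by
    intro z hz t
    simp only [F', dif_pos hz]
    rfl
  refine ⟨F', ?_, fun z hz => ?_, fun z hz => ⟨?_, ?_⟩⟩
  · rw [continuousOn_iff_continuous_domRestrict]
    refine G.continuous.congr fun z => ?_
    simp only [domRestrict_apply, F', dif_pos z.2]
  · ext t
    have h : (⟨⟨z, sphere_subset_closedBall hz⟩, t⟩ : K) ∈ A₁ := hz
    rw [hF' z (sphere_subset_closedBall hz), hF (Or.inl (Or.inl h)), hk1 h]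
  · have h : (⟨⟨z, hz⟩, 0⟩ : K) ∈ A₂ := rfl
    rw [hF' z hz, hF (Or.inl (Or.inr h)), hk2 h]
  · have h : (⟨⟨z, hz⟩, 1⟩ : K) ∈ A₃ := rfl
    rw [hF' z hz, hF (Or.inr h), hk3 h]

end CompactExtension

namespace Topology.CWComplex

open Metric

variable {W : Type*} [TopologicalSpace W] [T2Space W] [CWComplex (univ : Set W)]

/-- Closedness is tested on closed cells, where a preimage is the image of a compact subset of the
ball. Homotopies are treated as maps to the path space, so no cell structure on W × [0,1] is needed.
-/
theorem continuousOn_skeletonLT {Y : Type*} [TopologicalSpace Y] {H : W → Y} (N : ℕ∞)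
    (h : ∀ m : ℕ, m < N → ∀ j : cell (univ : Set W) m,
      ContinuousOn (H ∘ map m j) (closedBall 0 1)) :
    ContinuousOn H (skeletonLT (univ : Set W) N) := by
  rw [continuousOn_iff_isClosed]
  intro t ht
  refine ⟨H ⁻¹' t ∩ skeletonLT (univ : Set W) N, ?_, by rw [inter_assoc, inter_self]⟩
  refine isClosed_of_disjoint_openCell_or_isClosed_inter_closedCell (subset_univ _) fun m _ j => ?_
  by_cases hm : m < N
  · right
    have he : H ⁻¹' t ∩ skeletonLT (univ : Set W) N ∩ closedCell m j =
        map m j '' (closedBall 0 1 ∩ (H ∘ map m j) ⁻¹' t) := by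
      ext w
      constructor
      · rintro ⟨⟨hw, -⟩, z, hz, rfl⟩
        exact ⟨z, ⟨hz, hw⟩, rfl⟩
      · rintro ⟨z, ⟨hz, hw⟩, rfl⟩
        refine ⟨⟨hw, skeletonLT_mono (Order.add_one_le_of_lt hm)
          (closedCell_subset_skeletonLT m j ⟨z, hz, rfl⟩)⟩, z, hz, rfl⟩
    rw [he]
    refine IsCompact.isClosed (IsCompact.image_of_continuousOn ?_
      ((continuousOn m j).mono inter_subset_left))
    exact (isCompact_closedBall _ _).of_isClosed_subset
      ((h m hm j).preimage_isClosed_of_isClosed isClosed_closedBall ht) inter_subset_left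
  · left
    exact (disjoint_skeletonLT_openCell (not_lt.1 hm)).mono_left inter_subset_right

/-- One step of the construction of a homotopy by induction over the skeleta. -/
theorem exists_homotopy_step {X : Type*} [TopologicalSpace X] (hX : CompactExtension X)
    (g : C(W, X)) (x₀ : X) (n : ℕ) {H : W → C(unitInterval, X)}
    (hH : ContinuousOn H (skeletonLT (univ : Set W) n))
    (hH' : ∀ w ∈ skeletonLT (univ : Set W) n, H w 0 = g w ∧ H w 1 = x₀) :
    ∃ G : W → C(unitInterval, X), (ContinuousOn G (skeletonLT (univ : Set W) (n + 1 : ℕ)) ∧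
      ∀ w ∈ skeletonLT (univ : Set W) (n + 1 : ℕ), G w 0 = g w ∧ G w 1 = x₀) ∧
        EqOn G H (skeletonLT (univ : Set W) n) := by
  classical
  have hfr : ∀ j : cell (univ : Set W) n, MapsTo (map n j) (sphere 0 1)
      (skeletonLT (univ : Set W) n) := fun j z hz =>
    cellFrontier_subset_skeletonLT n j ⟨z, hz, rfl⟩
  have hF := fun j : cell (univ : Set W) n => hX.exists_path_extension (n := n)
    (H := H ∘ map n j) (g := g ∘ map n j)
    (hH.comp ((continuousOn n j).mono sphere_subset_closedBall) (hfr j))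
    (g.continuous.comp_continuousOn (continuousOn n j)) x₀
    (fun z hz => (hH' _ (hfr j hz)).1) fun z hz => (hH' _ (hfr j hz)).2
  choose F hFc hFs hF01 using hF
  -- Open cells of one dimension are disjoint, so the chosen cell is the only one containing the
  -- point.
  let G : W → C(unitInterval, X) := fun w =>
    if h : ∃ j : cell (univ : Set W) n, w ∈ openCell n j then F h.choose ((map n h.choose).symm w)
    else H w
  have hGH : EqOn G H (skeletonLT (univ : Set W) n) := by
    intro w hw
    refine dif_neg ?_
    rintro ⟨j, hj⟩
    exact (disjoint_skeletonLT_openCell le_rfl).le_bot ⟨hw, hj⟩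
  have hGF : ∀ j : cell (univ : Set W) n, EqOn (G ∘ map n j) (F j) (closedBall 0 1) := by
    intro j z hz
    rw [← sphere_union_ball] at hz
    obtain hz | hz := hz
    · exact (hGH (hfr j hz)).trans (hFs j hz).symm
    · have h : ∃ j' : cell (univ : Set W) n, map n j z ∈ openCell n j' := ⟨j, z, hz, rfl⟩
      have hj : h.choose = j := by
        have := eq_of_not_disjoint_openCell (C := (univ : Set W)) (n := n) (j := h.choose) (m := n)
          (i := j) (not_disjoint_iff.2 ⟨_, h.choose_spec, z, hz, rfl⟩)
        simpa using this
      have hG : G (map n j z) = F h.choose ((map n h.choose).symm (map n j z)) := dif_pos h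
      rw [Function.comp_apply, hG, hj, (map n j).left_inv (by rwa [source_eq n j])]
  have hcells : ∀ m : ℕ, (m : ℕ∞) < (n + 1 : ℕ) → ∀ j : cell (univ : Set W) m,
      ContinuousOn (G ∘ map m j) (closedBall 0 1) := by
    intro m hm j
    obtain hlt | rfl := (Nat.lt_succ_iff_lt_or_eq.1 (Nat.cast_lt.1 hm))
    · have hmaps : MapsTo (map m j) (closedBall 0 1) (skeletonLT (univ : Set W) n) := fun z hz =>
        skeletonLT_mono (by exact_mod_cast hlt) (closedCell_subset_skeletonLT m j ⟨z, hz, rfl⟩)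
      exact (hH.comp (continuousOn m j) hmaps).congr fun z hz => hGH (hmaps hz)
    · exact (hFc j).congr (hGF j)
  refine ⟨G, ⟨continuousOn_skeletonLT _ hcells, fun w hw => ?_⟩, hGH⟩
  obtain ⟨m, hm, j, hwj⟩ := mem_skeletonLT_iff.1 hw
  obtain hlt | rfl := (Nat.lt_succ_iff_lt_or_eq.1 (Nat.cast_lt.1 hm))
  · have hwn : w ∈ skeletonLT (univ : Set W) n :=
      mem_skeletonLT_iff.2 ⟨m, by exact_mod_cast hlt, j, hwj⟩
    rw [hGH hwn]
    exact hH' w hwn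
  · obtain ⟨z, hz, rfl⟩ := hwj
    have hz' := ball_subset_closedBall hz
    have h := hGF j hz'
    rw [Function.comp_apply] at h
    rw [h]
    exact hF01 j z hz'

theorem nullhomotopic_of_compactExtension {X : Type*} [TopologicalSpace X]
    (hX : CompactExtension X) (g : C(W, X)) : g.Nullhomotopic := by
  obtain ⟨x₀⟩ := hX.nonempty
  let Good : ℕ → (W → C(unitInterval, X)) → Prop := fun n H =>
    ContinuousOn H (skeletonLT (univ : Set W) n) ∧
      ∀ w ∈ skeletonLT (univ : Set W) n, H w 0 = g w ∧ H w 1 = x₀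
  choose step hstep hstepEq using fun (n : ℕ) (H : {H // Good n H}) =>
    exists_homotopy_step hX g x₀ n H.2.1 H.2.2
  have h0 : Good 0 fun _ => ContinuousMap.const _ x₀ :=
    ⟨continuousOn_const, fun w hw => by
      obtain ⟨m, hm, -⟩ := mem_skeletonLT_iff.1 hw
      exact absurd hm (by simp)⟩
  let S : ∀ n, {H // Good n H} := fun n => Nat.rec ⟨_, h0⟩ (fun n H => ⟨step n H, hstep n H⟩) n
  have hS : ∀ n m, n ≤ m → EqOn (S m).1 (S n).1 (skeletonLT (univ : Set W) n) := by
    intro n m hnm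
    induction m, hnm using Nat.le_induction with
    | base => exact fun _ _ => rfl
    | succ m hnm ih =>
      intro w hw
      exact (hstepEq m (S m) (skeletonLT_mono (by exact_mod_cast hnm) hw)).trans (ih hw)
  have hdim : ∀ w : W, ∃ n : ℕ, w ∈ skeletonLT (univ : Set W) n := fun w => by
    have hw : w ∈ ⋃ (n : ℕ) (j : cell (univ : Set W) n), openCell n j := by
      rw [iUnion_openCell_eq_complex]
      trivial
    obtain ⟨n, hn⟩ := mem_iUnion.1 hw
    obtain ⟨j, hj⟩ := mem_iUnion.1 hn
    exact ⟨n + 1, by exact_mod_cast openCell_subset_skeletonLT n j hj⟩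
  choose d hd using hdim
  -- The stages agree on smaller skeleta, so every sufficiently late stage gives the same value at
  -- `w`.
  let H : W → C(unitInterval, X) := fun w => (S (d w)).1 w
  have hHS : ∀ n, EqOn H (S n).1 (skeletonLT (univ : Set W) n) := by
    intro n w hw
    obtain h | h := le_total n (d w)
    · exact hS n (d w) h hw
    · exact (hS (d w) n h (hd w)).symm
  have hHc : Continuous H := by
    have h := continuousOn_skeletonLT (H := H) ⊤ fun m _ j => by
      have hmaps : MapsTo (map m j) (closedBall 0 1) (skeletonLT (univ : Set W) (m + 1 : ℕ)) :=
        fun z hz => by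
          have := closedCell_subset_skeletonLT m j ⟨z, hz, rfl⟩
          exact_mod_cast this
      exact ((S (m + 1)).2.1.comp (continuousOn m j) hmaps).congr
        fun z hz => hHS (m + 1) (hmaps hz)
    rw [skeletonLT_top] at h
    exact continuousOn_univ.1 h
  refine ⟨x₀, ⟨⟨⟨fun q => H q.2 q.1, ?_⟩, fun w => ?_, fun w => ?_⟩⟩⟩
  · exact (continuous_eval (F := C(unitInterval, X))).comp
      ((hHc.comp continuous_snd).prodMk continuous_fst)
  · exact ((S (d w)).2.2 w (hd w)).1
  · exact ((S (d w)).2.2 w (hd w)).2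

end Topology.CWComplex

/-- The identity of `X` factors up to homotopy through a map from the complex to `X`, which is
nullhomotopic. -/
theorem CompactExtension.contractibleSpace {X : Type*} [TopologicalSpace X]
    (hX : CompactExtension X) (h : IsHomotopyEquivCW X) : ContractibleSpace X := by
  obtain ⟨W, _, _, ⟨_⟩, ⟨e⟩⟩ := h
  rw [contractible_iff_id_nullhomotopic]
  obtain ⟨x₀, hx₀⟩ :=
    (Topology.CWComplex.nullhomotopic_of_compactExtension hX e.invFun).comp_left e.toFun
  exact ⟨x₀, e.left_inv.symm.trans hx₀⟩

/-! ### The extension property of the tangent bundle and its positive part. -/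

namespace LongRay

variable [ChartedSpace ℝ LongRay] [IsManifold 𝓘(ℝ, ℝ) 1 LongRay]

/-- Finitely many clamped charts cover the interval. Each is monotone everywhere and strictly so on
its piece, so the sum is strict on all pieces. -/
theorem exists_monotone_strictMonoOn_Icc (a b : LongRay) :
    ∃ Φ : LongRay → ℝ, Continuous Φ ∧ StrictMonoOn Φ (Icc a b) := by
  suffices h : ∃ Φ : LongRay → ℝ, Continuous Φ ∧ Monotone Φ ∧
      ∀ x ∈ Icc a b, ∀ y, x < y → Φ x < Φ y by
    obtain ⟨Φ, hc, -, h⟩ := h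
    exact ⟨Φ, hc, fun x hx y _ hxy => h x hx y hxy⟩
  refine isCompact_Icc.induction_on (p := fun s : Set LongRay => ∃ Φ : LongRay → ℝ,
    Continuous Φ ∧ Monotone Φ ∧ ∀ x ∈ s, ∀ y, x < y → Φ x < Φ y) ?_ ?_ ?_ ?_
  · exact ⟨fun _ => 0, continuous_const, monotone_const, fun x hx => absurd hx (notMem_empty x)⟩
  · rintro s t hst ⟨Φ, hc, hm, h⟩
    exact ⟨Φ, hc, hm, fun x hx => h x (hst hx)⟩
  · rintro s t ⟨Φ, hc, hm, h⟩ ⟨Ψ, hc', hm', h'⟩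
    refine ⟨fun x => Φ x + Ψ x, hc.add hc', hm.add hm', ?_⟩
    rintro x (hx | hx) y hxy
    · exact add_lt_add_of_lt_of_le (h x hx y hxy) (hm' hxy.le)
    · exact add_lt_add_of_le_of_lt (hm hxy.le) (h' x hx y hxy)
  · intro x₀ _
    obtain ⟨a, b, ha, hb, hsrc, s, hs, hmono⟩ := exists_coordinate x₀
    have hab := (ha.trans hb).le
    refine ⟨Ioo a b, mem_nhdsWithin_of_mem_nhds (Ioo_mem_nhds ha hb),
      fun x => s * chartAt ℝ x₀ (projIcc a b hab x), ?_, ?_, ?_⟩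
    · refine continuous_const.mul ?_
      exact ((chartAt ℝ x₀).continuousOn.mono hsrc).comp_continuous
        (continuous_subtype_val.comp continuous_projIcc) fun x => Subtype.prop _
    · exact fun x y hxy => hmono.monotoneOn (Subtype.prop _) (Subtype.prop _)
        (monotone_projIcc hab hxy)
    · intro x hx y hxy
      refine hmono (Subtype.prop _) (Subtype.prop _) ?_
      rw [projIcc_of_mem hab (Ioo_subset_Icc_self hx), coe_projIcc]
      exact lt_max_of_lt_right (lt_min hx.2 hxy)

/-- The sign of a nonzero tangent vector. -/
theorem isPositiveTangent_or_neg (x : LongRay) {w : ℝ} (hw : w ≠ 0) :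
    IsPositiveTangent x w ∨ IsPositiveTangent x (-w : ℝ) := by
  obtain ⟨a, b, ha, hb, hsrc, s, hs, hmono⟩ := exists_coordinate x
  have hx := hsrc ⟨ha.le, hb.le⟩
  have hd := mdifferentiableAt_chartAt hx
  have h0 : chartDeriv (fun y => s * chartAt ℝ x y) x ≠ 0 := by
    rw [chartDeriv_const_mul s hd]
    exact mul_ne_zero hs (chartDeriv_chartAt_ne_zero hx)
  have hiff := isPositiveTangent_iff ⟨ha, hb⟩ hmono (mdifferentiableAt_const_mul s hd) h0
  obtain h | h := (mul_ne_zero h0 hw).lt_or_gt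
  · right
    rw [hiff, mul_neg]
    exact neg_pos.2 h
  · left
    rwa [hiff]

/-- There is a continuous function on the tangent bundle that is linear on the fibers and is
positive on the positive vectors over a given compact interval. -/
theorem exists_fiber_coordinate (a b : LongRay) : ∃ k : LongRay → ℝ,
    Continuous (fun p : LongRayTangent => k p.1 * tangentCoord p) ∧
      ∀ x ∈ Icc a b, ∀ w : ℝ, IsPositiveTangent x w → 0 < k x * w := by
  -- Nonnegativity outside the controlled set lets the local functionals be added without
  -- cancellation.
  suffices h : ∃ k : LongRay → ℝ, Continuous (fun p : LongRayTangent => k p.1 * tangentCoord p) ∧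
      ∀ (x) (w : ℝ), IsPositiveTangent x w → 0 ≤ k x * w ∧ (x ∈ Icc a b → 0 < k x * w) by
    obtain ⟨k, hc, h⟩ := h
    exact ⟨k, hc, fun x hx w hw => (h x w hw).2 hx⟩
  refine isCompact_Icc.induction_on (p := fun s : Set LongRay => ∃ k : LongRay → ℝ,
    Continuous (fun p : LongRayTangent => k p.1 * tangentCoord p) ∧
      ∀ (x) (w : ℝ), IsPositiveTangent x w → 0 ≤ k x * w ∧ (x ∈ s → 0 < k x * w)) ?_ ?_ ?_ ?_
  · exact ⟨fun _ => 0, by simpa using continuous_const, fun x w _ =>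
      ⟨by simp, fun hx => absurd hx (notMem_empty x)⟩⟩
  · rintro s t hst ⟨k, hc, h⟩
    exact ⟨k, hc, fun x w hw => ⟨(h x w hw).1, fun hx => (h x w hw).2 (hst hx)⟩⟩
  · rintro s t ⟨k, hc, h⟩ ⟨k', hc', h'⟩
    refine ⟨fun x => k x + k' x, (hc.add hc').congr fun p => (add_mul _ _ _).symm,
      fun x w hw => ?_⟩
    simp only [add_mul]
    refine ⟨add_nonneg (h x w hw).1 (h' x w hw).1, ?_⟩
    rintro (hx | hx)
    · exact add_pos_of_pos_of_nonneg ((h x w hw).2 hx) (h' x w hw).1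
    · exact add_pos_of_nonneg_of_pos (h x w hw).1 ((h' x w hw).2 hx)
  · intro x₀ _
    obtain ⟨a, b, ha, hb, hsrc, s, hs, hmono⟩ := exists_coordinate x₀
    obtain ⟨a', ha', ha''⟩ := exists_between ha
    obtain ⟨b', hb'', hb'⟩ := exists_between hb
    have hdisj : Disjoint (Ioo a b)ᶜ (Icc a' b') := disjoint_left.2 fun x hx hx' =>
      hx ⟨ha'.trans_le hx'.1, hx'.2.trans_lt hb'⟩
    obtain ⟨ρ, hρ0, hρ1, hρ⟩ := exists_continuous_zero_one_of_isClosed isOpen_Ioo.isClosed_compl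
      isClosed_Icc hdisj
    refine ⟨Icc a' b', mem_nhdsWithin_of_mem_nhds (Icc_mem_nhds ha'' hb''),
      fun x => ρ x * (s * chartDeriv (chartAt ℝ x₀) x), ?_, fun x w hw => ?_⟩
    · rw [continuous_iff_continuousAt]
      intro p
      have hπ : Continuous fun q : LongRayTangent => q.1 :=
        FiberBundle.continuous_proj ℝ (TangentSpace 𝓘(ℝ, ℝ) (M := LongRay))
      by_cases hp : p.1 ∈ (chartAt ℝ x₀).source
      · have h1 := ((continuousOn_chartDeriv_mul x₀).continuousAt
          (((chartAt ℝ x₀).open_source.preimage hπ).mem_nhds hp))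
        have h2 : ContinuousAt (fun q : LongRayTangent => ρ q.1 * s) p :=
          ((ρ.continuous.comp hπ).mul continuous_const).continuousAt
        refine (h2.mul h1).congr (Eventually.of_forall fun q => ?_)
        simp only [Pi.mul_apply]
        ring
      · have hev : ∀ᶠ q : LongRayTangent in 𝓝 p, q.1 ∈ (Icc a b)ᶜ :=
          hπ.continuousAt.eventually (isClosed_Icc.isOpen_compl.mem_nhds fun h => hp (hsrc h))
        refine (continuousAt_const (y := (0 : ℝ))).congr (hev.mono fun q hq => ?_)
        have : ρ q.1 = 0 := hρ0 fun h => hq (Ioo_subset_Icc_self h)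
        simp [this]
    · have key : x ∈ Ioo a b → 0 < s * chartDeriv (chartAt ℝ x₀) x * w := fun hx => by
        have hx' := hsrc (Ioo_subset_Icc_self hx)
        have hd := mdifferentiableAt_chartAt hx'
        have h := isPositiveTangent_iff hx hmono (mdifferentiableAt_const_mul s hd) (by
          rw [chartDeriv_const_mul s hd]
          exact mul_ne_zero hs (chartDeriv_chartAt_ne_zero hx')) w
        rw [chartDeriv_const_mul s hd] at h
        exact h.1 hw
      rw [mul_assoc]
      constructor
      · by_cases hx : x ∈ Ioo a b
        · exact mul_nonneg (hρ x).1 (key hx).le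
        · rw [show ρ x = 0 from hρ0 hx, zero_mul]
      · intro hx
        rw [show ρ x = 1 from hρ1 hx, one_mul]
        exact key ⟨ha'.trans_le hx.1, hx.2.trans_lt hb'⟩

theorem ne_zero_of_fiber_coordinate {k : LongRay → ℝ} {x : LongRay}
    (hk : ∀ w : ℝ, IsPositiveTangent x w → 0 < k x * w) : k x ≠ 0 := fun h => by
  obtain hw | hw := isPositiveTangent_or_neg x (one_ne_zero (α := ℝ))
  · simpa [h] using hk _ hw
  · simpa [h] using hk _ hw

theorem isPositiveTangent_of_fiber_coordinate {k : LongRay → ℝ} {x : LongRay}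
    (hk : ∀ w : ℝ, IsPositiveTangent x w → 0 < k x * w) {w : ℝ} (h : 0 < k x * w) :
    IsPositiveTangent x w := by
  have hw : w ≠ 0 := by
    rintro rfl
    simp at h
  refine (isPositiveTangent_or_neg x hw).resolve_right fun hn => ?_
  have := hk _ hn
  linarith [mul_neg (k x) w]

/-- Neither `k` nor the chart derivative need be continuous, but their quotient is: it is the fiber
functional evaluated along a continuous local section. -/
theorem continuousOn_fiber_coordinate_symm {a b : LongRay} {k : LongRay → ℝ}
    (hc : Continuous (fun p : LongRayTangent => k p.1 * tangentCoord p))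
    (hk : ∀ x ∈ Icc a b, ∀ w : ℝ, IsPositiveTangent x w → 0 < k x * w) :
    ContinuousOn (fun q : LongRay × ℝ => tangentMk q.1 (q.2 / k q.1)) {q | q.1 ∈ Icc a b} := by
  rintro ⟨x₀, r₀⟩ hx₀
  have hsrc : ∀ᶠ x in 𝓝 x₀, x ∈ (chartAt ℝ x₀).source :=
    (chartAt ℝ x₀).open_source.mem_nhds (mem_chart_source ℝ x₀)
  have hσ : ContinuousAt (fun x => tangentMk x (chartDeriv (chartAt ℝ x₀) x)⁻¹) x₀ := by
    rw [← continuousWithinAt_univ, continuousWithinAt_tangent_iff]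
    refine ⟨continuousWithinAt_id, ?_⟩
    rw [continuousWithinAt_univ]
    refine (continuousAt_const (y := (1 : ℝ))).congr (hsrc.mono fun x hx => ?_)
    exact (mul_inv_cancel₀ (chartDeriv_chartAt_ne_zero hx)).symm
  have hkσ : ContinuousAt (fun x => k x * (chartDeriv (chartAt ℝ x₀) x)⁻¹) x₀ :=
    hc.continuousAt.comp hσ
  have hD : chartDeriv (chartAt ℝ x₀) x₀ ≠ 0 := chartDeriv_chartAt_ne_zero (mem_chart_source ℝ x₀)
  have hne : k x₀ * (chartDeriv (chartAt ℝ x₀) x₀)⁻¹ ≠ 0 :=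
    mul_ne_zero (ne_zero_of_fiber_coordinate (hk x₀ hx₀)) (inv_ne_zero hD)
  rw [continuousWithinAt_tangent_iff]
  refine ⟨continuous_fst.continuousWithinAt, ContinuousAt.continuousWithinAt ?_⟩
  have h := (continuous_snd (X := LongRay) (Y := ℝ)).continuousAt (x := (x₀, r₀)) |>.div
    (hkσ.comp (f := Prod.fst) (x := ((x₀, r₀) : LongRay × ℝ)) continuousAt_fst) hne
  refine h.congr (Eventually.of_forall fun q => ?_)
  change q.2 / (k q.1 * (chartDeriv (chartAt ℝ x₀) q.1)⁻¹) =
    chartDeriv (chartAt ℝ x₀) q.1 * (q.2 / k q.1)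
  rw [div_mul_eq_div_div, div_inv_eq_mul, mul_comm]

/-- The image of `f` lies in a compact interval homeomorphic to a real one, so Tietze applies after
clamping. The bounds are kept because the bundle is trivialized only over such an interval. -/
theorem exists_extension_Icc {K : Type*} [TopologicalSpace K] [CompactSpace K] [T2Space K]
    {A : Set K} (hA : IsClosed A) (f : C(A, LongRay)) : ∃ (a b : LongRay) (F : C(K, LongRay)),
      (∀ z, F z ∈ Icc a b) ∧ ∀ z : A, F z = f z := by
  have : CompactSpace A := isCompact_iff_compactSpace.1 hA.isCompact
  obtain ⟨a, ha⟩ := (isCompact_range f.continuous).bddBelow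
  obtain ⟨b₀, hb₀⟩ := (isCompact_range f.continuous).bddAbove
  obtain ⟨b, hb, hab⟩ : ∃ b, b₀ ≤ b ∧ a ≤ b := ⟨max a b₀, le_max_right _ _, le_max_left _ _⟩
  obtain ⟨Φ, hc, hΦ⟩ := exists_monotone_strictMonoOn_Icc a b
  have hΦab : Φ a ≤ Φ b := hΦ.monotoneOn ⟨le_rfl, hab⟩ ⟨hab, le_rfl⟩ hab
  let φ : Icc a b → Icc (Φ a) (Φ b) := fun x => ⟨Φ x,
    hΦ.monotoneOn ⟨le_rfl, hab⟩ x.2 x.2.1, hΦ.monotoneOn x.2 ⟨hab, le_rfl⟩ x.2.2⟩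
  have hφ : StrictMono φ := fun x y hxy => hΦ x.2 y.2 hxy
  have hφs : Function.Surjective φ := fun r => by
    obtain ⟨x, hx, hxr⟩ := intermediate_value_Icc hab hc.continuousOn r.2
    exact ⟨⟨x, hx⟩, Subtype.ext hxr⟩
  let e := (hφ.orderIsoOfSurjective φ hφs).toHomeomorph
  obtain ⟨ψ, hψ⟩ := ContinuousMap.exists_restrict_eq hA
    ((⟨Φ, hc⟩ : C(LongRay, ℝ)).comp f)
  refine ⟨a, b, ⟨fun z => (e.symm (projIcc _ _ hΦab (ψ z))).1, ?_⟩, fun z => Subtype.prop _,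
    fun z => ?_⟩
  · exact continuous_subtype_val.comp (e.symm.continuous.comp
      (continuous_projIcc.comp ψ.continuous))
  · have hfz : f z ∈ Icc a b := ⟨ha ⟨z, rfl⟩, (hb₀ ⟨z, rfl⟩).trans hb⟩
    have h1 : ψ z = Φ (f z) := congrArg (fun u : C(A, ℝ) => u z) hψ
    have h2 : projIcc _ _ hΦab (ψ z) = e ⟨f z, hfz⟩ := by
      rw [h1, projIcc_of_mem hΦab (φ ⟨f z, hfz⟩).2]
      rfl
    change (e.symm (projIcc _ _ hΦab (ψ z))).1 = f z
    rw [h2, e.symm_apply_apply]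

theorem compactExtension_tangent : CompactExtension LongRayTangent := by
  intro K _ _ _ A hA f
  have hπ : Continuous fun q : LongRayTangent => q.1 :=
    FiberBundle.continuous_proj ℝ (TangentSpace 𝓘(ℝ, ℝ) (M := LongRay))
  obtain ⟨a, b, B, hB, hBf⟩ := exists_extension_Icc hA ((⟨_, hπ⟩ : C(LongRayTangent, LongRay)).comp f)
  obtain ⟨k, hc, hk⟩ := exists_fiber_coordinate a b
  obtain ⟨R, hR⟩ := ContinuousMap.exists_restrict_eq hA ((⟨_, hc⟩ : C(LongRayTangent, ℝ)).comp f)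
  refine ⟨⟨fun z => tangentMk (B z) (R z / k (B z)),
    (continuousOn_fiber_coordinate_symm hc hk).comp_continuous
      (B.continuous.prodMk R.continuous) hB⟩, fun z => ?_⟩
  have h1 : B z = (f z).1 := hBf z
  have h2 : R z = k (f z).1 * tangentCoord (f z) := congrArg (fun u : C(A, ℝ) => u z) hR
  have hk0 : k (f z).1 ≠ 0 := h1 ▸ ne_zero_of_fiber_coordinate (hk _ (hB z))
  change tangentMk (B z) (R z / k (B z)) = f z
  rw [h1, h2, mul_div_cancel_left₀ _ hk0]
  rfl

theorem compactExtension_positiveTangent : CompactExtension PositiveTangent := by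
  intro K _ _ _ A hA f
  obtain ⟨a, b, B, hB, hBf⟩ := exists_extension_Icc hA
    ((⟨_, continuous_proj⟩ : C(PositiveTangent, LongRay)).comp f)
  obtain ⟨k, hc, hk⟩ := exists_fiber_coordinate a b
  have hB' : ∀ z : A, B z = (f z).1.1 := hBf
  have hpos : ∀ z : A, 0 < k (f z).1.1 * tangentCoord (f z).1 := fun z =>
    hk _ (hB' z ▸ hB z) _ (f z).2
  -- The logarithm turns the positive fiber coordinate into an arbitrary real one for Tietze. The
  -- exponential then restores positivity of the extension.
  have hlog : Continuous fun z : A => Real.log (k (f z).1.1 * tangentCoord (f z).1) :=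
    (hc.comp (continuous_subtype_val.comp f.continuous)).log fun z => (hpos z).ne'
  obtain ⟨R, hR⟩ := ContinuousMap.exists_restrict_eq hA ⟨_, hlog⟩
  have hk0 : ∀ z, k (B z) ≠ 0 := fun z => ne_zero_of_fiber_coordinate (hk _ (hB z))
  refine ⟨⟨fun z => ⟨tangentMk (B z) (Real.exp (R z) / k (B z)), ?_⟩, ?_⟩, fun z => ?_⟩
  · refine isPositiveTangent_of_fiber_coordinate (hk _ (hB z)) ?_
    change 0 < k (B z) * (Real.exp (R z) / k (B z))
    rw [mul_div_cancel₀ _ (hk0 z)]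
    exact Real.exp_pos _
  · exact ((continuousOn_fiber_coordinate_symm hc hk).comp_continuous
      (B.continuous.prodMk (Real.continuous_exp.comp R.continuous)) hB).subtype_mk _
  · have h1 := hB' z
    have h2 : R z = Real.log (k (f z).1.1 * tangentCoord (f z).1) :=
      congrArg (fun u : C(A, ℝ) => u z) hR
    refine Subtype.ext ?_
    change tangentMk (B z) (Real.exp (R z) / k (B z)) = (f z).1
    rw [h2, Real.exp_log (hpos z), h1, mul_div_cancel_left₀ _ (h1 ▸ hk0 z)]
    rfl

end LongRay

theorem theorem1p6 [ChartedSpace ℝ LongRay] [IsManifold 𝓘(ℝ, ℝ) 1 LongRay] :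
    (∀ h : C(PositiveTangent × unitInterval, LongRay),
      (∃ t₀ : unitInterval, IsLindelof (Set.range fun p : PositiveTangent => h (p, t₀))) →
        ∀ t : unitInterval, AlmostConstant fun p : PositiveTangent => h (p, t)) ∧
    ¬ ContractibleSpace PositiveTangent ∧
    ¬ IsHomotopyEquivCW.{0, v} PositiveTangent ∧
    ¬ IsHomotopyEquivCW.{0, v} LongRayTangent :=
  ⟨fun h ⟨t₀, ht₀⟩ t => LongRay.almostConstant_of_isLindelof h t₀ ht₀ t,
    LongRay.not_contractibleSpace_positiveTangent,
    fun h => LongRay.not_contractibleSpace_positiveTangent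
      (LongRay.compactExtension_positiveTangent.contractibleSpace h),
    fun h => LongRay.not_contractibleSpace_tangent
      (LongRay.compactExtension_tangent.contractibleSpace h)⟩
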